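/- Let $\mathcal S_1,\mathcal S_2,\mathcal Z,\mathcal X_1,\mathcal X_2,\mathcal Y,\hat{\mathcal S}_1,\hat{\mathcal S}_2$ be finite alphabets, let $p(s_1,s_2,z)$ be a probability mass function on $\mathcal S_1\times\mathcal S_2\times\mathcal Z$, let $p(y|x_1,x_2)$ be a discrete memoryless multiple access channel with inputs in $\mathcal X_1,\mathcal X_2$ and output in $\mathcal Y$, and let $d_j:\mathcal S_j\times\hat{\mathcal S}_j\to\mathbb R$ ($j=1,2$) be distortion measures. The triples $(S_{1i},S_{2i},Z_i)$, $i=1,2,\dots$, are i.i.d. with law $p(s_1,s_2,z)$. A code of block length $n$ consists of encoders $e_j:\mathcal S_j^n\to\mathcal X_j^n$ and decoders $h_j:\mathcal Y^n\times\mathcal Z^n\to\hat{\mathcal S}_j^n$ ($j=1,2$): encoder $j$ sends $X_j^n=e_j(S_j^n)$ over the channel, which is used without feedback, and the decoder, which observes the channel output $Y^n$ and the side information $Z^n$, forms $\hat S_j^n=h_j(Y^n,Z^n)$. The pair $(D_1,D_2)\in\mathbb R^2$ is called achievable if for every $\varepsilon>0$ and all sufficiently large $n$ there is a code of block length $n$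 with $$\frac1n\sum_{i=1}^n\mathbb E\big[d_j(S_{ji},\hat S_{ji})\big]\le D_j+\varepsilon,\qquad j=1,2.$$ Theorem. The pair $(D_1,D_2)$ is achievable if there exist finite alphabets $\mathcal U_1,\mathcal U_2$, conditional probability mass functions $p(u_1|s_1)$ and $p(u_2|s_2)$, and functions $x_j:\mathcal U_j\times\mathcal S_j\to\mathcal X_j$ and $g_j:\mathcal U_1\times\mathcal U_2\times\mathcal Y\times\mathcal Z\to\hat{\mathcal S}_j$ for $j=1,2$, such that, for random variables with joint law $$p(u_1,u_2,s_1,s_2,z,y)=p(s_1,s_2,z)\,p(u_1|s_1)\,p(u_2|s_2)\,p\big(y\,|\,x_1(u_1,s_1),x_2(u_2,s_2)\big),$$ one has \begin{align*} I(U_1;S_1|U_2,Z)&<I(U_1;Y|U_2,Z),\\ I(U_2;S_2|U_1,Z)&<I(U_2;Y|U_1,Z),\\ I(U_1,U_2;S_1,S_2|Z)&<I(U_1,U_2;Y|Z), \end{align*} and $\mathbb E[d_j(S_j,g_j(U_1,U_2,Y,Z))]\le D_j$ for $j=1,2$. -/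

import Mathlib

open scoped BigOperators

namespace HybridMAC

noncomputable section

/-! ### Information measures for random variables on a finite sample space -/

section Information

variable {Ω α β γ : Type*} [Fintype Ω]

open Classical in
/-- The probability `P(A = a)` when the sample space `Ω` carries the mass function `P`. -/
def marginal (P : Ω → ℝ) (A : Ω → α) (a : α) : ℝ :=
  ∑ ω, if A ω = a then P ω else 0

/-- The expectation `E[f]` under the mass function `P`. -/
def expect (P : Ω → ℝ) (f : Ω → ℝ) : ℝ := ∑ ω, P ω * f ω

/-- Conditional mutual information (in nats)
`I(A; B | C) = E[ log ( p(A,B|C) / (p(A|C) p(B|C)) ) ]`, the argument of the logarithm being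
written as `p(A,B,C) p(C) / (p(A,C) p(B,C))`. Sample points of mass zero contribute zero. -/
def condMutualInfo (P : Ω → ℝ) (A : Ω → α) (B : Ω → β) (C : Ω → γ) : ℝ :=
  expect P fun ω =>
    Real.log
      (marginal P (fun ω' => (A ω', B ω', C ω')) (A ω, B ω, C ω) * marginal P C (C ω) /
        (marginal P (fun ω' => (A ω', C ω')) (A ω, C ω) *
          marginal P (fun ω' => (B ω', C ω')) (B ω, C ω)))

end Information

/-! ### Block codes and achievable distortion pairs

`S₁, S₂` are the source alphabets, `Z` that of the decoder side information, `X₁, X₂` and `Y`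
the input and output alphabets of the multiple access channel, `T₁, T₂` the reconstruction
alphabets. -/

section Coding

variable {S₁ S₂ Z X₁ X₂ Y T₁ T₂ : Type*}

/-- A block code of length `n`: encoder `j` sees only the `j`-th source block, the decoder sees
the channel output block and the side information block. -/
structure BlockCode (S₁ S₂ Z X₁ X₂ Y T₁ T₂ : Type*) (n : ℕ) where
  enc₁ : (Fin n → S₁) → (Fin n → X₁)
  enc₂ : (Fin n → S₂) → (Fin n → X₂)
  dec₁ : (Fin n → Y) → (Fin n → Z) → (Fin n → T₁)
  dec₂ : (Fin n → Y) → (Fin n → Z) → (Fin n → T₂)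

/-- The joint law of the source and side information block `s` (i.i.d. with law `p`) and of the
output block `y` of the memoryless channel `W` when the code `c` is used. -/
def blockLaw (p : PMF (S₁ × S₂ × Z)) (W : X₁ → X₂ → PMF Y) {n : ℕ}
    (c : BlockCode S₁ S₂ Z X₁ X₂ Y T₁ T₂ n) :
    (Fin n → S₁ × S₂ × Z) × (Fin n → Y) → ℝ := fun (s, y) =>
  (∏ i, (p (s i)).toReal) *
    ∏ i, (W (c.enc₁ (fun k => (s k).1) i) (c.enc₂ (fun k => (s k).2.1) i) (y i)).toReal

variable [Fintype S₁] [Fintype S₂] [Fintype Z] [Fintype Y]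

/-- `(1/n) ∑ᵢ E[d₁(S₁ᵢ, Ŝ₁ᵢ)]`. -/
def avgDistortion₁ (p : PMF (S₁ × S₂ × Z)) (W : X₁ → X₂ → PMF Y) (d₁ : S₁ → T₁ → ℝ) {n : ℕ}
    (c : BlockCode S₁ S₂ Z X₁ X₂ Y T₁ T₂ n) : ℝ :=
  (1 / (n : ℝ)) * ∑ i, expect (blockLaw p W c) fun (s, y) =>
    d₁ (s i).1 (c.dec₁ y (fun k => (s k).2.2) i)

/-- `(1/n) ∑ᵢ E[d₂(S₂ᵢ, Ŝ₂ᵢ)]`. -/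
def avgDistortion₂ (p : PMF (S₁ × S₂ × Z)) (W : X₁ → X₂ → PMF Y) (d₂ : S₂ → T₂ → ℝ) {n : ℕ}
    (c : BlockCode S₁ S₂ Z X₁ X₂ Y T₁ T₂ n) : ℝ :=
  (1 / (n : ℝ)) * ∑ i, expect (blockLaw p W c) fun (s, y) =>
    d₂ (s i).2.1 (c.dec₂ y (fun k => (s k).2.2) i)

/-- `(D₁, D₂)` is achievable: for every `ε > 0` and every large enough block length `n` there is
a code whose two average expected distortions are at most `D₁ + ε` and `D₂ + ε`. -/
def Achievable (p : PMF (S₁ × S₂ × Z)) (W : X₁ → X₂ → PMF Y)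
    (d₁ : S₁ → T₁ → ℝ) (d₂ : S₂ → T₂ → ℝ) (D₁ D₂ : ℝ) : Prop :=
  ∀ ε : ℝ, 0 < ε → ∃ N : ℕ, ∀ n : ℕ, N ≤ n →
    ∃ c : BlockCode S₁ S₂ Z X₁ X₂ Y T₁ T₂ n,
      avgDistortion₁ p W d₁ c ≤ D₁ + ε ∧ avgDistortion₂ p W d₂ c ≤ D₂ + ε

end Coding

/-! ### The single-letter distribution -/

section SingleLetter

variable {U₁ U₂ S₁ S₂ Z X₁ X₂ Y : Type*}

/-- Realizations of `(U₁, U₂, S₁, S₂, Z, Y)`. -/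
abbrev Letter (U₁ U₂ S₁ S₂ Z Y : Type*) : Type _ := U₁ × U₂ × S₁ × S₂ × Z × Y

/-- The joint law
`p(u₁,u₂,s₁,s₂,z,y) = p(s₁,s₂,z) p(u₁|s₁) p(u₂|s₂) p(y | x₁(u₁,s₁), x₂(u₂,s₂))`. -/
def jointLaw (p : PMF (S₁ × S₂ × Z)) (W : X₁ → X₂ → PMF Y)
    (q₁ : S₁ → PMF U₁) (q₂ : S₂ → PMF U₂) (x₁ : U₁ → S₁ → X₁) (x₂ : U₂ → S₂ → X₂) :
    Letter U₁ U₂ S₁ S₂ Z Y → ℝ := fun (u₁, u₂, s₁, s₂, z, y) =>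
  (p (s₁, s₂, z)).toReal * (q₁ s₁ u₁).toReal * (q₂ s₂ u₂).toReal *
    (W (x₁ u₁ s₁) (x₂ u₂ s₂) y).toReal

/-- The random variable `U₁`. -/
def rvU₁ : Letter U₁ U₂ S₁ S₂ Z Y → U₁ := fun (u₁, _, _, _, _, _) => u₁

/-- The random variable `U₂`. -/
def rvU₂ : Letter U₁ U₂ S₁ S₂ Z Y → U₂ := fun (_, u₂, _, _, _, _) => u₂

/-- The random variable `S₁`. -/
def rvS₁ : Letter U₁ U₂ S₁ S₂ Z Y → S₁ := fun (_, _, s₁, _, _, _) => s₁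

/-- The random variable `S₂`. -/
def rvS₂ : Letter U₁ U₂ S₁ S₂ Z Y → S₂ := fun (_, _, _, s₂, _, _) => s₂

/-- The random variable `Z`. -/
def rvZ : Letter U₁ U₂ S₁ S₂ Z Y → Z := fun (_, _, _, _, z, _) => z

/-- The random variable `Y`. -/
def rvY : Letter U₁ U₂ S₁ S₂ Z Y → Y := fun (_, _, _, _, _, y) => y

end SingleLetter

end

end HybridMAC

/-! The code. Encoder `j` owns a random codebook of about `exp(n(I(U_j;S_j) + 2δ))` codewords drawn
i.i.d. from the law of `U_j`. It picks a codeword with probability proportional to its likelihood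
given the source block and sends `x_j` of codeword and source, letter by letter. The decoder takes
any pair of codewords for which three likelihood ratios against `(Y, Z)` are large enough, and
applies `g_j` letter by letter.

The difficulty is that the chosen codeword depends on the whole codebook, so the other codewords are
not independent of what was sent. Soft covering removes it (`sum_iid_abs_one_sub_average_le`,
`IsDensityData.sum_likelihoodEncoder_le`). Given the sources, the law of codebook and index is close
in L¹ to one where the index is uniform and independent of the codebook, and the source enters only
through a density factor of the selected codeword. This needs the codebook rate to exceed
`I(U_j;S_j)`. The two encoders are replaced one after the other for fixed sources, so correlation of
the sources is harmless.

Under the idealized law the selected codewords, the sources, the side information and the output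
have exactly the desired joint law, and every other codeword is a fresh independent draw. A change
of measure (`sum_mul_sum_ind_le`) bounds the probability that a false codeword passes the test, and
a union bound over false first, false second and both false indices
(`IsDensityData.sum_codeWeight_testDecoder_le`) gives three packing conditions. Averaging then fixes
the codebooks and makes the encoders deterministic (`IsDensityData.exists_code`).

All this is one-shot. It is applied to product laws, where the weak law of large numbers controls
the densities. The resulting conditions are `I(U₁;S₁) < I(U₁;U₂,Y,Z)`, its mirror image, and a joint
one. Since `U₁ – S₁ – (U₂,S₂,Z)` is Markov, and likewise with the roles exchanged, the gaps equal
those between the conditional mutual informations of the theorem (`condMutualInfo_sub₁`,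
`condMutualInfo_sub₂`, `condMutualInfo_sub₁₂`).

For the distortion, the one-shot bound is used with the event that the empirical distortion at the
decoded symbols is too large. This event has vanishing probability, and distortions on a finite
alphabet are bounded. -/

namespace HybridMAC

noncomputable section

/-! ### Weighted averages and marginals -/

section Averages

/-- A finite weighted average that is at most `B` has a term that is at most `B`. -/
theorem exists_le_of_weighted_sum_le {α : Type*} [Fintype α] {w f : α → ℝ} {B : ℝ}
    (hw : ∀ a, 0 ≤ w a) (hw1 : ∑ a, w a = 1) (h : ∑ a, w a * f a ≤ B) : ∃ a, f a ≤ B := by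
  by_contra! hc
  have h0 : ∑ a, w a * (f a - B) ≤ 0 := by
    simp only [mul_sub, Finset.sum_sub_distrib, ← Finset.sum_mul, hw1]
    linarith
  have hnn : ∀ a ∈ Finset.univ, 0 ≤ w a * (f a - B) := fun a _ =>
    mul_nonneg (hw a) (by linarith [hc a])
  have hz := (Finset.sum_eq_zero_iff_of_nonneg hnn).1 (le_antisymm h0 (Finset.sum_nonneg hnn))
  have hw0 : ∀ a, w a = 0 := fun a => by
    rcases mul_eq_zero.1 (hz a (Finset.mem_univ a)) with h | h
    · exact h
    · linarith [hc a]
  simp [hw0] at hw1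

/-- Averaging a function of a random variable against its marginal law. -/
theorem sum_mul_comp_eq_sum_marginal {Ω α : Type*} [Fintype Ω] [Fintype α] (P : Ω → ℝ)
    (A : Ω → α) (H : α → ℝ) : ∑ ω, P ω * H (A ω) = ∑ a, marginal P A a * H a := by
  classical
  simp only [marginal, Finset.sum_mul]
  rw [Finset.sum_comm]
  refine Finset.sum_congr rfl fun ω _ => ?_
  rw [Finset.sum_eq_single (A ω)]
  · simp
  · intro b _ hb; simp [Ne.symm hb]
  · simp

theorem marginal_nonneg {Ω α : Type*} [Fintype Ω] {P : Ω → ℝ} (hP : ∀ ω, 0 ≤ P ω)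
    (A : Ω → α) (a : α) : 0 ≤ marginal P A a := by
  classical
  exact Finset.sum_nonneg fun ω _ => by split_ifs <;> simp [hP]

theorem le_marginal {Ω α : Type*} [Fintype Ω] {P : Ω → ℝ} (hP : ∀ ω, 0 ≤ P ω)
    (A : Ω → α) (ω : Ω) : P ω ≤ marginal P A (A ω) := by
  classical
  unfold marginal
  refine le_trans ?_ (Finset.single_le_sum (f := fun ω' => if A ω' = A ω then P ω' else 0)
    (fun i _ => by split_ifs <;> simp [hP]) (Finset.mem_univ ω))
  simp

theorem sum_marginal {Ω α : Type*} [Fintype Ω] [Fintype α] (P : Ω → ℝ)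
    (A : Ω → α) : ∑ a, marginal P A a = ∑ ω, P ω := by
  simpa using (sum_mul_comp_eq_sum_marginal P A fun _ => 1).symm

end Averages

/-! ### Independent draws: first and second moments, weak law of large numbers -/

section Product

variable {ι U : Type*} [Fintype ι] [DecidableEq ι] [Fintype U]

/-- The mass function of independent draws with law `w`, indexed by `ι`. -/
def iid (ι : Type*) [Fintype ι] {U : Type*} (w : U → ℝ) (C : ι → U) : ℝ := ∏ i, w (C i)

theorem iid_nonneg {ι U : Type*} [Fintype ι] {w : U → ℝ} (hw : ∀ u, 0 ≤ w u) (C : ι → U) :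
    0 ≤ iid ι w C :=
  Finset.prod_nonneg fun _ _ => hw _

theorem sum_prod_apply (f : ι → U → ℝ) : ∑ C : ι → U, ∏ i, f i (C i) = ∏ i, ∑ u, f i u := by
  rw [Finset.prod_univ_sum]; simp

theorem sum_iid {w : U → ℝ} (hw1 : ∑ u, w u = 1) : ∑ C : ι → U, iid ι w C = 1 := by
  simp only [iid, sum_prod_apply fun _ => w, hw1, Finset.prod_const_one]

theorem sum_iid_apply {w : U → ℝ} (hw1 : ∑ u, w u = 1) (m : ι) (f : U → ℝ) :
    ∑ C : ι → U, iid ι w C * f (C m) = ∑ u, w u * f u := by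
  have h := sum_prod_apply (ι := ι) fun i u => w u * if i = m then f u else 1
  simp only [Finset.prod_mul_distrib, Finset.prod_ite_eq', Finset.mem_univ, if_true] at h
  refine h.trans ?_
  rw [Finset.prod_eq_single m]
  · simp
  · intro b _ hb; simp [hb, hw1]
  · simp

theorem sum_iid_apply_mul_apply {w : U → ℝ} (hw1 : ∑ u, w u = 1) {m m' : ι} (hm : m ≠ m')
    (f g : U → ℝ) : ∑ C : ι → U, iid ι w C * (f (C m) * g (C m')) =
      (∑ u, w u * f u) * ∑ u, w u * g u := by
  have h := sum_prod_apply (ι := ι) fun i u =>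
    w u * ((if i = m then f u else 1) * (if i = m' then g u else 1))
  simp only [Finset.prod_mul_distrib, Finset.prod_ite_eq', Finset.mem_univ, if_true] at h
  refine h.trans ?_
  rw [← Finset.mul_prod_erase _ _ (Finset.mem_univ m),
    ← Finset.mul_prod_erase _ _ (Finset.mem_erase.2 ⟨hm.symm, Finset.mem_univ m'⟩)]
  rw [Finset.prod_eq_one]
  · simp [hm, hm.symm]
  · intro i hi
    simp only [Finset.mem_erase, Finset.mem_univ, and_true] at hi
    simp [hi.1, hi.2, hw1]

/-- Fixing the value `u` of the first coordinate by an indicator reduces a general `F` to products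
of functions of one coordinate each. This is where independence of a sent and a competing codeword
is used. -/
theorem sum_iid_apply_apply {w : U → ℝ} (hw1 : ∑ u, w u = 1) {m m' : ι} (hm : m ≠ m')
    (F : U → U → ℝ) : ∑ C : ι → U, iid ι w C * F (C m) (C m') =
      ∑ u, ∑ u', w u * w u' * F u u' := by
  classical
  have h : ∀ C : ι → U, iid ι w C * F (C m) (C m') =
      ∑ u, iid ι w C * ((if C m = u then 1 else 0) * F u (C m')) := fun C => by
    rw [Finset.sum_eq_single (C m)]
    · simp
    · intro b _ hb; simp [Ne.symm hb]
    · simp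
  simp only [h]
  rw [Finset.sum_comm]
  refine Finset.sum_congr rfl fun u _ => ?_
  rw [sum_iid_apply_mul_apply hw1 hm (fun v => if v = u then 1 else 0)]
  simp [Finset.mul_sum, mul_assoc]

/-- The second moment of a sum of independent centred variables. -/
theorem sum_iid_sq {w : U → ℝ} (hw1 : ∑ u, w u = 1) (X : U → ℝ) (hX : ∑ u, w u * X u = 0) :
    ∑ C : ι → U, iid ι w C * (∑ i, X (C i)) ^ 2 = Fintype.card ι * ∑ u, w u * X u ^ 2 := by
  have h : ∀ C : ι → U, iid ι w C * (∑ i, X (C i)) ^ 2 =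
      ∑ i, ∑ j, iid ι w C * (X (C i) * X (C j)) := fun C => by
    rw [sq, Finset.sum_mul_sum]; simp only [Finset.mul_sum]
  simp only [h]
  rw [Finset.sum_comm]
  have h2 : ∀ i : ι, ∑ C : ι → U, ∑ j, iid ι w C * (X (C i) * X (C j)) =
      ∑ u, w u * X u ^ 2 := fun i => by
    rw [Finset.sum_comm, Finset.sum_eq_single i]
    · rw [← sum_iid_apply (ι := ι) hw1 i]; simp only [sq]
    · intro j _ hj
      rw [sum_iid_apply_mul_apply hw1 hj.symm, hX, zero_mul]
    · simp
  simp [h2]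

theorem marginal_iid {Ω α : Type*} [Fintype Ω] (P : Ω → ℝ) (A : Ω → α) (a : ι → α) :
    marginal (iid ι P) (fun ω i => A (ω i)) a = ∏ i, marginal P A (a i) := by
  classical
  simp only [marginal]
  rw [← sum_prod_apply fun i ω => if A ω = a i then P ω else 0]
  refine Finset.sum_congr rfl fun ω _ => ?_
  by_cases h : ∀ i, A (ω i) = a i
  · simp [h, iid]
  · rw [if_neg (by simpa [funext_iff] using h)]
    push Not at h
    obtain ⟨i, hi⟩ := h
    exact (Finset.prod_eq_zero (Finset.mem_univ i) (by simp [hi])).symm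

open Classical in
/-- The weak law of large numbers, in the form of Chebyshev's inequality. -/
theorem sum_iid_deviation_le {w : U → ℝ} (hw : ∀ u, 0 ≤ w u) (hw1 : ∑ u, w u = 1) (f : U → ℝ)
    {ε : ℝ} (hε : 0 < ε) {n : ℕ} (hn : 0 < n) :
    ∑ C : Fin n → U, iid (Fin n) w C *
        (if n * ε ≤ |∑ i, f (C i) - n * ∑ u, w u * f u| then 1 else 0) ≤
      (∑ u, w u * (f u - ∑ v, w v * f v) ^ 2) / ε ^ 2 / n := by
  set μ := ∑ v, w v * f v with hμ
  have hn' : (0 : ℝ) < n := by exact_mod_cast hn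
  have hs := sum_iid_sq (ι := Fin n) hw1 (fun u => f u - μ)
    (by simp [mul_sub, ← Finset.sum_mul, hw1, hμ])
  rw [div_div, le_div_iff₀ (by positivity), Finset.sum_mul]
  have key : ∑ C : Fin n → U, iid (Fin n) w C *
        (if n * ε ≤ |∑ i, f (C i) - n * μ| then 1 else 0) * (ε ^ 2 * n) * n ≤
      ∑ C : Fin n → U, iid (Fin n) w C * (∑ i, (f (C i) - μ)) ^ 2 := by
    refine Finset.sum_le_sum fun C _ => ?_
    rw [mul_assoc, mul_assoc]
    refine mul_le_mul_of_nonneg_left ?_ (iid_nonneg hw C)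
    have : ∑ i, (f (C i) - μ) = ∑ i, f (C i) - n * μ := by simp
    rw [this]
    split_ifs with h
    · rw [← sq_abs (_ - _)]
      calc 1 * (ε ^ 2 * n * n) = (n * ε) ^ 2 := by ring
        _ ≤ _ := by gcongr
    · rw [zero_mul]; positivity
  rw [hs, ← Finset.sum_mul] at key
  simp only [Fintype.card_fin] at key
  exact le_of_mul_le_mul_right (key.trans_eq (mul_comm _ _)) hn'

open Classical in
theorem tendsto_sum_iid_deviation {w : U → ℝ} (hw : ∀ u, 0 ≤ w u) (hw1 : ∑ u, w u = 1)
    (f : U → ℝ) {ε : ℝ} (hε : 0 < ε) :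
    Filter.Tendsto (fun n : ℕ => ∑ C : Fin n → U, iid (Fin n) w C *
        (if n * ε ≤ |∑ i, f (C i) - n * ∑ u, w u * f u| then 1 else 0))
      Filter.atTop (nhds 0) := by
  refine tendsto_of_tendsto_of_tendsto_of_le_of_le' tendsto_const_nhds
    (tendsto_const_div_atTop_nhds_zero_nat
      ((∑ u, w u * (f u - ∑ v, w v * f v) ^ 2) / ε ^ 2)) ?_ ?_
  · refine Filter.Eventually.of_forall fun n => Finset.sum_nonneg fun C _ =>
      mul_nonneg (iid_nonneg hw C) (by split_ifs <;> simp)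
  · filter_upwards [Filter.eventually_gt_atTop 0] with n hn
    exact sum_iid_deviation_le hw hw1 f hε hn

end Product

/-! ### Soft covering and the likelihood encoder -/

section SoftCovering

variable {ι U S : Type*} [Fintype ι] [Nonempty ι]

open Classical in
/-- Soft covering: the empirical average of a nonnegative unit-mean function `L` over a random
codebook is close to one, up to the contribution of the values of `L` above `τ`. -/
theorem sum_iid_abs_one_sub_average_le [DecidableEq ι] [Fintype U] {w L : U → ℝ}
    (hw : ∀ u, 0 ≤ w u) (hw1 : ∑ u, w u = 1) (hL : ∀ u, 0 ≤ L u) (hL1 : ∑ u, w u * L u = 1) {τ c : ℝ} (hc : 0 < c)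
    (hτ0 : 0 ≤ τ) (hτ : τ ≤ c ^ 2 * Fintype.card ι) :
    ∑ C : ι → U, iid ι w C * |1 - (1 / (Fintype.card ι : ℝ)) * ∑ m, L (C m)| ≤
      2 * (∑ u, w u * L u * if τ < L u then 1 else 0) + c := by
  set M : ℝ := ((Fintype.card ι : ℕ) : ℝ) with hM
  have hM0 : 0 < M := by rw [hM]; exact_mod_cast Fintype.card_pos
  -- Truncation at `τ`: the bounded part `A` has variance at most `τ`, while the remainder `B` is
  -- only controlled in mean. Its mean `b` is paid twice, once because `A` has mean `1 - b` and once
  -- for the average of `B` itself.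
  set A : U → ℝ := fun u => L u * if τ < L u then 0 else 1 with hA
  set B : U → ℝ := fun u => L u * if τ < L u then 1 else 0 with hB
  have hAB : ∀ u, L u = A u + B u := fun u => by simp only [hA, hB]; split_ifs <;> simp
  have hB0 : ∀ u, 0 ≤ B u := fun u => mul_nonneg (hL u) (by split_ifs <;> simp)
  have hA0 : ∀ u, 0 ≤ A u := fun u => mul_nonneg (hL u) (by split_ifs <;> simp)
  have hAτ : ∀ u, A u ≤ τ := fun u => by
    simp only [hA]; split_ifs with h
    · simpa
    · simpa using h
  set μ := ∑ u, w u * A u with hμ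
  set b := ∑ u, w u * B u with hb
  have hμb : μ + b = 1 := by
    rw [← hL1, hμ, hb, ← Finset.sum_add_distrib]
    exact Finset.sum_congr rfl fun u _ => by rw [hAB u]; ring
  have hbb : ∑ u, w u * L u * (if τ < L u then 1 else 0) = b :=
    Finset.sum_congr rfl fun u _ => by simp only [hB]; ring
  have hb0 : 0 ≤ b := Finset.sum_nonneg fun u _ => mul_nonneg (hw u) (hB0 u)
  have hμ0 : 0 ≤ μ := Finset.sum_nonneg fun u _ => mul_nonneg (hw u) (hA0 u)
  have hμ1 : μ ≤ 1 := by linarith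
  have hEX := sum_iid_sq (ι := ι) hw1 (fun u => A u - μ)
    (by simp [mul_sub, ← Finset.sum_mul, hw1, hμ])
  have hvar : ∑ u, w u * (A u - μ) ^ 2 ≤ τ := by
    have h1 : ∑ u, w u * (A u - μ) ^ 2 = ∑ u, w u * A u ^ 2 - μ ^ 2 := by
      have : ∀ u, w u * (A u - μ) ^ 2 = w u * A u ^ 2 - 2 * μ * (w u * A u) + μ ^ 2 * w u :=
        fun u => by ring
      simp only [this, Finset.sum_add_distrib, Finset.sum_sub_distrib, ← Finset.mul_sum, hw1,
        ← hμ]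
      ring
    have h2 : ∑ u, w u * A u ^ 2 ≤ ∑ u, τ * (w u * A u) := Finset.sum_le_sum fun u _ => by
      nlinarith [mul_nonneg (mul_nonneg (hw u) (hA0 u)) (sub_nonneg.2 (hAτ u))]
    rw [← Finset.mul_sum, ← hμ] at h2
    nlinarith [sq_nonneg μ]
  have hpt : ∀ C : ι → U, |1 - (1 / M) * ∑ m, L (C m)| ≤
      (c / 2 + (1 / (2 * c * M ^ 2)) * (∑ m, (A (C m) - μ)) ^ 2) + b +
        (1 / M) * ∑ m, B (C m) := fun C => by
    have e1 : 1 - (1 / M) * ∑ m, L (C m) =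
        -((1 / M) * ∑ m, (A (C m) - μ)) + b - (1 / M) * ∑ m, B (C m) := by
      simp only [hAB, Finset.sum_add_distrib, Finset.sum_sub_distrib, Finset.sum_const,
        Finset.card_univ, nsmul_eq_mul, ← hM]
      have : 1 / M * (M * μ) = μ := by field_simp
      linear_combination -this - hμb
    set X := (1 / M) * ∑ m, (A (C m) - μ) with hX
    have hX2 : (1 / (2 * c * M ^ 2)) * (∑ m, (A (C m) - μ)) ^ 2 = X ^ 2 / (2 * c) := by
      rw [hX]; field_simp
    have hBn : 0 ≤ (1 / M) * ∑ m, B (C m) :=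
      mul_nonneg (by positivity) (Finset.sum_nonneg fun _ _ => hB0 _)
    -- The arithmetic-geometric mean inequality, in place of Cauchy-Schwarz, passes from the first
    -- moment to the second. With `τ ≤ c² M` the two halves contribute `c / 2` each after averaging.
    have hXa : |X| ≤ c / 2 + X ^ 2 / (2 * c) := by
      have : c / 2 + X ^ 2 / (2 * c) - |X| = (|X| - c) ^ 2 / (2 * c) := by
        field_simp; rw [← sq_abs X]; ring
      have h3 : 0 ≤ (|X| - c) ^ 2 / (2 * c) := by positivity
      linarith
    rw [e1, hX2]
    rw [abs_le]
    constructor <;> [linarith [neg_abs_le X, le_abs_self X]; linarith [neg_abs_le X]]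
  calc ∑ C : ι → U, iid ι w C * |1 - (1 / M) * ∑ m, L (C m)|
      ≤ ∑ C : ι → U, iid ι w C * ((c / 2 + (1 / (2 * c * M ^ 2)) *
          (∑ m, (A (C m) - μ)) ^ 2) + b + (1 / M) * ∑ m, B (C m)) :=
        Finset.sum_le_sum fun C _ => mul_le_mul_of_nonneg_left (hpt C) (iid_nonneg hw C)
    _ = (c / 2) * (∑ C : ι → U, iid ι w C) + (1 / (2 * c * M ^ 2)) *
          (∑ C : ι → U, iid ι w C * (∑ m, (A (C m) - μ)) ^ 2) +
          b * (∑ C : ι → U, iid ι w C) +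
          (1 / M) * ∑ m, ∑ C : ι → U, iid ι w C * B (C m) := by
        rw [Finset.sum_comm]
        simp only [Finset.mul_sum, ← Finset.sum_add_distrib]
        refine Finset.sum_congr rfl fun C _ => ?_
        simp only [mul_add, Finset.mul_sum]
        have : ∀ m, iid ι w C * (1 / M * B (C m)) = 1 / M * (iid ι w C * B (C m)) :=
          fun m => by ring
        simp only [this]; ring
    _ = c / 2 + (1 / (2 * c * M ^ 2)) * (M * ∑ u, w u * (A u - μ) ^ 2) + b + b := by
        simp only [sum_iid hw1, hEX, sum_iid_apply hw1, ← hb, Finset.sum_const,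
          Finset.card_univ, nsmul_eq_mul, ← hM]
        field_simp
    _ ≤ c / 2 + (1 / (2 * c * M ^ 2)) * (M * (c ^ 2 * M)) + b + b := by
        gcongr; exact hvar.trans hτ
    _ = 2 * b + c := by field_simp; ring
    _ = _ := by rw [hbb]

/-- The likelihood encoder: an index is drawn with probability proportional to the likelihood
of the codeword it selects. -/
def likelihoodEncoder {ι U S : Type*} [Fintype ι] (L : U → S → ℝ) (C : ι → U) (s : S) (m : ι) :
    ℝ :=
  if ∑ m', L (C m') s = 0 then 1 / (Fintype.card ι : ℝ) else L (C m) s / ∑ m', L (C m') s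

theorem likelihoodEncoder_nonneg {ι U S : Type*} [Fintype ι] {L : U → S → ℝ}
    (hL : ∀ u s, 0 ≤ L u s) (C : ι → U) (s : S) (m : ι) : 0 ≤ likelihoodEncoder L C s m := by
  unfold likelihoodEncoder
  split_ifs
  · positivity
  · exact div_nonneg (hL _ _) (Finset.sum_nonneg fun _ _ => hL _ _)

theorem sum_likelihoodEncoder (L : U → S → ℝ) (C : ι → U) (s : S) :
    ∑ m, likelihoodEncoder L C s m = 1 := by
  unfold likelihoodEncoder
  split_ifs with h
  · simp
  · rw [← Finset.sum_div, div_self h]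

/-- Both weight vectors are proportional to the likelihoods `L (C m) s`, so their differences all
have the same sign and the L¹ distance collapses to the difference of the total masses. If all
likelihoods vanish, both sides equal one. -/
theorem sum_abs_likelihoodEncoder_sub {L : U → S → ℝ} (hL : ∀ u s, 0 ≤ L u s) (C : ι → U)
    (s : S) : ∑ m, |likelihoodEncoder L C s m - (1 / (Fintype.card ι : ℝ)) * L (C m) s| =
      |1 - (1 / (Fintype.card ι : ℝ)) * ∑ m, L (C m) s| := by
  unfold likelihoodEncoder
  split_ifs with h
  · have h0 : ∀ m, L (C m) s = 0 := fun m =>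
      (Finset.sum_eq_zero_iff_of_nonneg fun _ _ => hL _ _).1 h m (Finset.mem_univ m)
    simp [h0]
  · set σ := ∑ m', L (C m') s with hσ
    have hσ0 : 0 < σ := lt_of_le_of_ne (Finset.sum_nonneg fun _ _ => hL _ _) (Ne.symm h)
    have : ∀ m, |L (C m) s / σ - (1 / (Fintype.card ι : ℝ)) * L (C m) s| =
        L (C m) s * (|1 - (1 / (Fintype.card ι : ℝ)) * σ| / σ) := fun m => by
      rw [show L (C m) s / σ - (1 / (Fintype.card ι : ℝ)) * L (C m) s =
        (L (C m) s / σ) * (1 - (1 / (Fintype.card ι : ℝ)) * σ) by field_simp, abs_mul,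
        abs_of_nonneg (div_nonneg (hL _ _) hσ0.le)]
      ring
    simp only [this, ← Finset.sum_mul, ← hσ]
    field_simp

end SoftCovering

/-! ### Real-valued indicators -/

section Indicator

open Classical in
/-- The indicator of a proposition. -/
def ind (A : Prop) : ℝ := if A then 1 else 0

theorem ind_nonneg (A : Prop) : 0 ≤ ind A := by unfold ind; split_ifs <;> simp

theorem ind_le_one (A : Prop) : ind A ≤ 1 := by unfold ind; split_ifs <;> simp

theorem ind_of {A : Prop} (h : A) : ind A = 1 := if_pos h

theorem ind_of_not {A : Prop} (h : ¬A) : ind A = 0 := if_neg h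

theorem ind_mono {A B : Prop} (h : A → B) : ind A ≤ ind B := by
  by_cases hA : A
  · rw [ind_of hA, ind_of (h hA)]
  · rw [ind_of_not hA]; exact ind_nonneg B

end Indicator

/-! ### Random codebooks with a uniform index -/

section CodeWeight

variable {ι U : Type*} [Fintype ι] [DecidableEq ι] [Nonempty ι] [Fintype U]

/-- The law of an i.i.d. codebook together with an independent uniform index. -/
def codeWeight {ι U : Type*} [Fintype ι] (w : U → ℝ) (a : (ι → U) × ι) : ℝ :=
  iid ι w a.1 * (1 / (Fintype.card ι : ℝ))

theorem codeWeight_nonneg {ι U : Type*} [Fintype ι] {w : U → ℝ} (hw : ∀ u, 0 ≤ w u)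
    (a : (ι → U) × ι) : 0 ≤ codeWeight w a :=
  mul_nonneg (iid_nonneg hw _) (by positivity)

theorem sum_codeWeight_mul {w : U → ℝ} (hw1 : ∑ u, w u = 1) (F : U → ℝ) :
    ∑ a : (ι → U) × ι, codeWeight w a * F (a.1 a.2) = ∑ u, w u * F u := by
  rw [Fintype.sum_prod_type, Finset.sum_comm]
  have : ∀ m : ι, ∑ C : ι → U, codeWeight w (C, m) * F (C m) =
      (1 / (Fintype.card ι : ℝ)) * ∑ u, w u * F u := fun m => by
    rw [← sum_iid_apply (ι := ι) hw1 m, Finset.mul_sum]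
    exact Finset.sum_congr rfl fun C _ => by simp only [codeWeight]; ring
  simp [this]

/-- Codewords at distinct indices are independent, so each of the fewer than `Fintype.card ι`
competitors contributes the average of `F` over independent pairs. This is the union bound over
false codewords. -/
theorem sum_codeWeight_mul_sum_le {w : U → ℝ} (hw : ∀ u, 0 ≤ w u) (hw1 : ∑ u, w u = 1)
    {F : U → U → ℝ} (hF : ∀ u v, 0 ≤ F u v) :
    ∑ a : (ι → U) × ι, codeWeight w a *
        (∑ m', if m' = a.2 then 0 else F (a.1 a.2) (a.1 m')) ≤
      Fintype.card ι * ∑ u, ∑ v, w u * w v * F u v := by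
  rw [Fintype.sum_prod_type, Finset.sum_comm]
  set R := ∑ u, ∑ v, w u * w v * F u v with hR
  have hR0 : 0 ≤ R := Finset.sum_nonneg fun u _ => Finset.sum_nonneg fun v _ =>
    mul_nonneg (mul_nonneg (hw u) (hw v)) (hF u v)
  have hM : (0 : ℝ) < Fintype.card ι := by exact_mod_cast Fintype.card_pos
  have : ∀ m : ι, ∑ C : ι → U, codeWeight w (C, m) *
      (∑ m', if m' = m then 0 else F (C m) (C m')) ≤ R := fun m => by
    have e : ∑ C : ι → U, codeWeight w (C, m) * (∑ m', if m' = m then 0 else F (C m) (C m')) =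
        (1 / (Fintype.card ι : ℝ)) * ∑ m', if m' = m then 0 else R := by
      simp only [Finset.mul_sum]
      rw [Finset.sum_comm]
      refine Finset.sum_congr rfl fun m' _ => ?_
      by_cases h : m' = m
      · simp [h]
      · simp only [h, if_false]
        rw [hR, ← sum_iid_apply_apply hw1 (Ne.symm h) F, Finset.mul_sum]
        exact Finset.sum_congr rfl fun C _ => by simp only [codeWeight]; ring
    rw [e]
    calc _ ≤ (1 / (Fintype.card ι : ℝ)) * ∑ _m' : ι, R := by
          gcongr; split_ifs <;> simp [hR0]
      _ = R := by simp
  calc _ ≤ ∑ _m : ι, R := Finset.sum_le_sum fun m _ => this m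
    _ = _ := by simp

end CodeWeight

/-- Replaces one factor at a time: `AB - A'B' = (A - A')B + A'(B - B')`. It allows the two encoders
to be idealized separately although `F` couples them. -/
theorem sum_sum_mul_le_add {α β : Type*} [Fintype α] [Fintype β] {A A' : α → ℝ} {B B' : β → ℝ}
    {F : α → β → ℝ} (hF : ∀ a b, 0 ≤ F a b) (hF1 : ∀ a b, F a b ≤ 1)
    (hB : ∀ b, 0 ≤ B b) (hB1 : ∑ b, B b = 1) (hA' : ∀ a, 0 ≤ A' a) (hA'1 : ∑ a, A' a = 1) :
    ∑ a, ∑ b, A a * B b * F a b ≤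
      ∑ a, ∑ b, A' a * B' b * F a b + ((∑ a, |A a - A' a|) + ∑ b, |B b - B' b|) := by
  have hp : ∀ a b, A a * B b * F a b ≤
      A' a * B' b * F a b + (|A a - A' a| * B b + A' a * |B b - B' b|) := fun a b => by
    have e : A a * B b * F a b =
      A' a * B' b * F a b + ((A a - A' a) * F a b * B b + A' a * ((B b - B' b) * F a b)) := by
      ring
    have hx : ∀ x : ℝ, x * F a b ≤ |x| := fun x =>
      (mul_le_mul_of_nonneg_right (le_abs_self x) (hF a b)).trans
        (mul_le_of_le_one_right (abs_nonneg x) (hF1 a b))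
    rw [e]
    gcongr
    · exact hB b
    · exact hx _
    · exact hA' a
    · exact hx _
  calc _ ≤ ∑ a, ∑ b, (A' a * B' b * F a b + (|A a - A' a| * B b + A' a * |B b - B' b|)) :=
        Finset.sum_le_sum fun a _ => Finset.sum_le_sum fun b _ => hp a b
    _ = _ := by
        simp only [Finset.sum_add_distrib, ← Finset.mul_sum, hB1, ← Finset.sum_mul, hA'1]
        ring

/-! ### L¹ distance between the likelihood encoder and a uniform index -/

section LikelihoodWeight

variable {ι U S : Type*} [Fintype ι] [DecidableEq ι] [Nonempty ι] [Fintype U]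

theorem sum_iid_mul_likelihoodEncoder {w : U → ℝ} (hw1 : ∑ u, w u = 1) (L : U → S → ℝ) (s : S) :
    ∑ a : (ι → U) × ι, iid ι w a.1 * likelihoodEncoder L a.1 s a.2 = 1 := by
  rw [Fintype.sum_prod_type]
  simp only [← Finset.mul_sum, sum_likelihoodEncoder, mul_one, sum_iid hw1]

/-- For each codebook the sum over indices is the deviation of the average likelihood from one, so
the soft covering bound applies verbatim. -/
theorem sum_abs_iid_mul_likelihoodEncoder_sub_le {w : U → ℝ} {L : U → S → ℝ}
    (hw : ∀ u, 0 ≤ w u) (hw1 : ∑ u, w u = 1)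
    (hL : ∀ u s, 0 ≤ L u s) (hL1 : ∀ s, ∑ u, w u * L u s = 1) {τ c : ℝ} (hc : 0 < c)
    (hτ0 : 0 ≤ τ) (hτ : τ ≤ c ^ 2 * Fintype.card ι) (s : S) :
    ∑ a : (ι → U) × ι, |iid ι w a.1 * likelihoodEncoder L a.1 s a.2 -
        codeWeight w a * L (a.1 a.2) s| ≤
      2 * (∑ u, w u * L u s * ind (τ < L u s)) + c := by
  refine le_trans (le_of_eq ?_)
    (sum_iid_abs_one_sub_average_le (ι := ι) hw hw1 (fun u => hL u s) (hL1 s) hc hτ0 hτ)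
  rw [Fintype.sum_prod_type]
  refine Finset.sum_congr rfl fun C _ => ?_
  rw [← sum_abs_likelihoodEncoder_sub hL, Finset.mul_sum]
  refine Finset.sum_congr rfl fun m _ => ?_
  simp only [codeWeight]
  rw [mul_assoc, ← mul_sub, abs_mul, abs_of_nonneg (iid_nonneg hw C)]

end LikelihoodWeight

/-! ### One-shot joint law and idealization of both encoders -/

section OneShot

variable {S₁ S₂ Z Y U₁ U₂ ι₁ ι₂ : Type*} [Fintype S₁] [Fintype S₂] [Fintype Z] [Fintype Y]
  [Fintype U₁] [Fintype U₂]

/-- The joint law of auxiliary variables, sources, side information and channel output, the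
test channels being given by their densities `L₁`, `L₂` with respect to `w₁`, `w₂`. -/
def densityLaw (p : S₁ × S₂ × Z → ℝ) (w₁ : U₁ → ℝ) (L₁ : U₁ → S₁ → ℝ) (w₂ : U₂ → ℝ)
    (L₂ : U₂ → S₂ → ℝ) (V : U₁ → S₁ → U₂ → S₂ → Y → ℝ) : Letter U₁ U₂ S₁ S₂ Z Y → ℝ :=
  fun (u₁, u₂, s₁, s₂, z, y) =>
    p (s₁, s₂, z) * (w₁ u₁ * L₁ u₁ s₁) * (w₂ u₂ * L₂ u₂ s₂) * V u₁ s₁ u₂ s₂ y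

variable {p : S₁ × S₂ × Z → ℝ} {w₁ : U₁ → ℝ} {L₁ : U₁ → S₁ → ℝ} {w₂ : U₂ → ℝ}
  {L₂ : U₂ → S₂ → ℝ} {V : U₁ → S₁ → U₂ → S₂ → Y → ℝ}

theorem sum_densityLaw_mul (H : Letter U₁ U₂ S₁ S₂ Z Y → ℝ) :
    ∑ ω, densityLaw p w₁ L₁ w₂ L₂ V ω * H ω =
      ∑ u₁, w₁ u₁ * ∑ u₂, w₂ u₂ * ∑ s : S₁ × S₂ × Z, ∑ y,
        p s * L₁ u₁ s.1 * L₂ u₂ s.2.1 * V u₁ s.1 u₂ s.2.1 y *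
          H (u₁, u₂, s.1, s.2.1, s.2.2, y) := by
  simp only [Fintype.sum_prod_type, Finset.mul_sum, densityLaw]
  refine Finset.sum_congr rfl fun _ _ => Finset.sum_congr rfl fun _ _ =>
    Finset.sum_congr rfl fun _ _ => Finset.sum_congr rfl fun _ _ =>
    Finset.sum_congr rfl fun _ _ => Finset.sum_congr rfl fun _ _ => ?_
  ring

/-- With the sources outermost, the output and either auxiliary variable can be summed out through
their normalizations. -/
theorem sum_densityLaw_mul_source (H : Letter U₁ U₂ S₁ S₂ Z Y → ℝ) :
    ∑ ω, densityLaw p w₁ L₁ w₂ L₂ V ω * H ω =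
      ∑ s : S₁ × S₂ × Z, p s * ∑ u₁, w₁ u₁ * L₁ u₁ s.1 * ∑ u₂, w₂ u₂ * L₂ u₂ s.2.1 *
        ∑ y, V u₁ s.1 u₂ s.2.1 y * H (u₁, u₂, s.1, s.2.1, s.2.2, y) := by
  rw [sum_densityLaw_mul]
  simp only [Finset.mul_sum]
  rw [Finset.sum_comm' (s := Finset.univ (α := S₁ × S₂ × Z)) (t' := Finset.univ (α := U₁))
    (s' := fun _ => Finset.univ) (by simp)]
  refine Finset.sum_congr rfl fun u₁ _ => ?_
  rw [Finset.sum_comm]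
  refine Finset.sum_congr rfl fun _ _ => Finset.sum_congr rfl fun _ _ =>
    Finset.sum_congr rfl fun _ _ => ?_
  ring

/-- Assumptions on the ingredients of `densityLaw` that make it a probability mass function. -/
structure IsDensityData (p : S₁ × S₂ × Z → ℝ) (w₁ : U₁ → ℝ) (L₁ : U₁ → S₁ → ℝ) (w₂ : U₂ → ℝ)
    (L₂ : U₂ → S₂ → ℝ) (V : U₁ → S₁ → U₂ → S₂ → Y → ℝ) : Prop where
  p_nonneg : ∀ s, 0 ≤ p s
  p_sum : ∑ s, p s = 1
  w₁_nonneg : ∀ u, 0 ≤ w₁ u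
  w₁_sum : ∑ u, w₁ u = 1
  w₂_nonneg : ∀ u, 0 ≤ w₂ u
  w₂_sum : ∑ u, w₂ u = 1
  L₁_nonneg : ∀ u s, 0 ≤ L₁ u s
  L₁_sum : ∀ s, ∑ u, w₁ u * L₁ u s = 1
  L₂_nonneg : ∀ u s, 0 ≤ L₂ u s
  L₂_sum : ∀ s, ∑ u, w₂ u * L₂ u s = 1
  V_nonneg : ∀ u₁ s₁ u₂ s₂ y, 0 ≤ V u₁ s₁ u₂ s₂ y
  V_sum : ∀ u₁ s₁ u₂ s₂, ∑ y, V u₁ s₁ u₂ s₂ y = 1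

namespace IsDensityData

theorem law_nonneg (h : IsDensityData p w₁ L₁ w₂ L₂ V) (ω : Letter U₁ U₂ S₁ S₂ Z Y) :
    0 ≤ densityLaw p w₁ L₁ w₂ L₂ V ω :=
  mul_nonneg (mul_nonneg (mul_nonneg (h.p_nonneg _)
    (mul_nonneg (h.w₁_nonneg _) (h.L₁_nonneg _ _)))
    (mul_nonneg (h.w₂_nonneg _) (h.L₂_nonneg _ _))) (h.V_nonneg _ _ _ _ _)

theorem sum_law_mul₁ (h : IsDensityData p w₁ L₁ w₂ L₂ V) (f : U₁ → S₁ → ℝ) :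
    ∑ ω, densityLaw p w₁ L₁ w₂ L₂ V ω * f (rvU₁ ω) (rvS₁ ω) =
      ∑ s, p s * ∑ u, w₁ u * L₁ u s.1 * f u s.1 := by
  rw [sum_densityLaw_mul_source]
  simp only [rvU₁, rvS₁, ← Finset.sum_mul, h.V_sum, one_mul, h.L₂_sum]

theorem sum_law_mul₂ (h : IsDensityData p w₁ L₁ w₂ L₂ V) (f : U₂ → S₂ → ℝ) :
    ∑ ω, densityLaw p w₁ L₁ w₂ L₂ V ω * f (rvU₂ ω) (rvS₂ ω) =
      ∑ s, p s * ∑ u, w₂ u * L₂ u s.2.1 * f u s.2.1 := by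
  rw [sum_densityLaw_mul_source]
  simp only [rvU₂, rvS₂, ← Finset.sum_mul, h.V_sum, one_mul, h.L₁_sum]

theorem law_sum (h : IsDensityData p w₁ L₁ w₂ L₂ V) :
    ∑ ω, densityLaw p w₁ L₁ w₂ L₂ V ω = 1 := by
  simpa [h.L₁_sum, h.p_sum] using h.sum_law_mul₁ fun _ _ => 1

end IsDensityData

variable [Fintype ι₁] [Fintype ι₂] [DecidableEq ι₁] [DecidableEq ι₂] [Nonempty ι₁] [Nonempty ι₂]

/-- Replacing both likelihood encoders by uniform indices and reweighted sources. -/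
theorem IsDensityData.sum_likelihoodEncoder_le (h : IsDensityData p w₁ L₁ w₂ L₂ V)
    {τ₁ c₁ τ₂ c₂ : ℝ} (hc₁ : 0 < c₁) (hτ₁0 : 0 ≤ τ₁) (hτ₁ : τ₁ ≤ c₁ ^ 2 * Fintype.card ι₁)
    (hc₂ : 0 < c₂) (hτ₂0 : 0 ≤ τ₂) (hτ₂ : τ₂ ≤ c₂ ^ 2 * Fintype.card ι₂)
    {F : S₁ × S₂ × Z → (ι₁ → U₁) × ι₁ → (ι₂ → U₂) × ι₂ → ℝ}
    (hF : ∀ s a b, 0 ≤ F s a b) (hF1 : ∀ s a b, F s a b ≤ 1) :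
    ∑ s, p s * ∑ a : (ι₁ → U₁) × ι₁, ∑ b : (ι₂ → U₂) × ι₂,
        iid ι₁ w₁ a.1 * likelihoodEncoder L₁ a.1 s.1 a.2 *
          (iid ι₂ w₂ b.1 * likelihoodEncoder L₂ b.1 s.2.1 b.2) * F s a b ≤
      ∑ s, p s * (∑ a : (ι₁ → U₁) × ι₁, ∑ b : (ι₂ → U₂) × ι₂,
        codeWeight w₁ a * L₁ (a.1 a.2) s.1 * (codeWeight w₂ b * L₂ (b.1 b.2) s.2.1) * F s a b) +
      (2 * (∑ ω, densityLaw p w₁ L₁ w₂ L₂ V ω * ind (τ₁ < L₁ (rvU₁ ω) (rvS₁ ω))) + c₁) +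
      (2 * (∑ ω, densityLaw p w₁ L₁ w₂ L₂ V ω * ind (τ₂ < L₂ (rvU₂ ω) (rvS₂ ω))) + c₂) := by
  rw [h.sum_law_mul₁ fun u s => ind (τ₁ < L₁ u s), h.sum_law_mul₂ fun u s => ind (τ₂ < L₂ u s)]
  -- The constants are spread over the sources so that the bound can be proved for each source
  -- triple separately.
  have e : ∀ c : ℝ, c = ∑ s, p s * c := fun c => by rw [← Finset.sum_mul, h.p_sum, one_mul]
  rw [e c₁, e c₂, Finset.mul_sum, Finset.mul_sum, ← Finset.sum_add_distrib,
    ← Finset.sum_add_distrib, ← Finset.sum_add_distrib, ← Finset.sum_add_distrib]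
  refine Finset.sum_le_sum fun s _ => ?_
  have hA'1 : ∑ a : (ι₁ → U₁) × ι₁, codeWeight w₁ a * L₁ (a.1 a.2) s.1 = 1 := by
    rw [sum_codeWeight_mul h.w₁_sum fun u => L₁ u s.1, h.L₁_sum]
  have key := sum_sum_mul_le_add (hF s) (hF1 s)
    (A := fun a => iid ι₁ w₁ a.1 * likelihoodEncoder L₁ a.1 s.1 a.2)
    (A' := fun a => codeWeight w₁ a * L₁ (a.1 a.2) s.1)
    (B := fun b => iid ι₂ w₂ b.1 * likelihoodEncoder L₂ b.1 s.2.1 b.2)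
    (B' := fun b => codeWeight w₂ b * L₂ (b.1 b.2) s.2.1)
    (fun b => mul_nonneg (iid_nonneg h.w₂_nonneg _) (likelihoodEncoder_nonneg h.L₂_nonneg _ _ _))
    (sum_iid_mul_likelihoodEncoder h.w₂_sum L₂ s.2.1)
    (fun a => mul_nonneg (codeWeight_nonneg h.w₁_nonneg _) (h.L₁_nonneg _ _)) hA'1
  have k₁ := sum_abs_iid_mul_likelihoodEncoder_sub_le h.w₁_nonneg h.w₁_sum h.L₁_nonneg h.L₁_sum
    hc₁ hτ₁0 hτ₁ s.1
  have k₂ := sum_abs_iid_mul_likelihoodEncoder_sub_le h.w₂_nonneg h.w₂_sum h.L₂_nonneg h.L₂_sum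
    hc₂ hτ₂0 hτ₂ s.2.1
  refine (mul_le_mul_of_nonneg_left (key.trans
    (add_le_add le_rfl (add_le_add k₁ k₂))) (h.p_nonneg s)).trans_eq ?_
  ring

end OneShot

/-! ### The decoder, its union bound, and the change of measure -/

section Decoder

variable {S₁ S₂ Z Y U₁ U₂ ι₁ ι₂ : Type*} [Nonempty ι₁] [Nonempty ι₂]

/-- The decoder: some pair of indices whose codewords pass the test `T`, if there is one. -/
def testDecoder (T : U₁ → U₂ → Y → Z → Prop) (C₁ : ι₁ → U₁) (C₂ : ι₂ → U₂) (y : Y) (z : Z) :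
    ι₁ × ι₂ :=
  Classical.epsilon fun m => T (C₁ m.1) (C₂ m.2) y z

/-- If the true pair `(m₁, m₂)` fails the test, its failure term is already one. Otherwise the
decoded pair passes; either it is the true pair, or it is counted in the sum for a wrong first, a
wrong second, or two wrong indices. The event `Bad` refers to decoded codewords, so a decoding error
is simply charged as bad. -/
theorem ind_testDecoder_le [Fintype ι₁] [Fintype ι₂] [DecidableEq ι₁] [DecidableEq ι₂]
    (T : U₁ → U₂ → Y → Z → Prop)
    (Bad : Letter U₁ U₂ S₁ S₂ Z Y → Prop) (C₁ : ι₁ → U₁) (C₂ : ι₂ → U₂) (m₁ : ι₁) (m₂ : ι₂)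
    (s₁ : S₁) (s₂ : S₂) (z : Z) (y : Y) :
    ind (Bad (C₁ (testDecoder T C₁ C₂ y z).1, C₂ (testDecoder T C₁ C₂ y z).2, s₁, s₂, z, y)) ≤
      (ind (Bad (C₁ m₁, C₂ m₂, s₁, s₂, z, y)) + ind (¬T (C₁ m₁) (C₂ m₂) y z)) +
      (∑ m', if m' = m₁ then 0 else ind (T (C₁ m') (C₂ m₂) y z)) +
      (∑ m', if m' = m₂ then 0 else ind (T (C₁ m₁) (C₂ m') y z)) +
      ∑ m', if m' = m₁ then 0 else ∑ m'', if m'' = m₂ then 0 else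
        ind (T (C₁ m') (C₂ m'') y z) := by
  have n₁ : ∀ m' : ι₁, 0 ≤ if m' = m₁ then 0 else ind (T (C₁ m') (C₂ m₂) y z) := fun m' => by
    split_ifs <;> [exact le_rfl; exact ind_nonneg _]
  have n₂ : ∀ m' : ι₂, 0 ≤ if m' = m₂ then 0 else ind (T (C₁ m₁) (C₂ m') y z) := fun m' => by
    split_ifs <;> [exact le_rfl; exact ind_nonneg _]
  have n₃ : ∀ (m' : ι₁) (m'' : ι₂), 0 ≤ if m'' = m₂ then 0 else
      ind (T (C₁ m') (C₂ m'') y z) := fun m' m'' => by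
    split_ifs <;> [exact le_rfl; exact ind_nonneg _]
  have n₄ : ∀ m' : ι₁, 0 ≤ if m' = m₁ then 0 else ∑ m'', if m'' = m₂ then 0 else
      ind (T (C₁ m') (C₂ m'') y z) := fun m' => by
    split_ifs
    · exact le_rfl
    · exact Finset.sum_nonneg fun m'' _ => n₃ m' m''
  have N₁ := Finset.sum_nonneg fun m' (_ : m' ∈ Finset.univ) => n₁ m'
  have N₂ := Finset.sum_nonneg fun m' (_ : m' ∈ Finset.univ) => n₂ m'
  have N₄ := Finset.sum_nonneg fun m' (_ : m' ∈ Finset.univ) => n₄ m'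
  have i₁ := ind_nonneg (Bad (C₁ m₁, C₂ m₂, s₁, s₂, z, y))
  have i₂ := ind_nonneg (¬T (C₁ m₁) (C₂ m₂) y z)
  set d := testDecoder T C₁ C₂ y z with hd
  have iB := ind_le_one (Bad (C₁ d.1, C₂ d.2, s₁, s₂, z, y))
  by_cases hT : T (C₁ m₁) (C₂ m₂) y z
  swap
  · rw [ind_of hT] at *
    linarith
  have hdT : T (C₁ d.1) (C₂ d.2) y z :=
    Classical.epsilon_spec (p := fun m : ι₁ × ι₂ => T (C₁ m.1) (C₂ m.2) y z) ⟨(m₁, m₂), hT⟩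
  by_cases e₁ : d.1 = m₁ <;> by_cases e₂ : d.2 = m₂
  · rw [e₁, e₂]; linarith
  · have := Finset.single_le_sum (fun m' _ => n₂ m') (Finset.mem_univ d.2)
    rw [if_neg e₂, ind_of (e₁ ▸ hdT)] at this
    linarith
  · have := Finset.single_le_sum (fun m' _ => n₁ m') (Finset.mem_univ d.1)
    rw [if_neg e₁, ind_of (e₂ ▸ hdT)] at this
    linarith
  · have h1 := Finset.single_le_sum (fun m' _ => n₄ m') (Finset.mem_univ d.1)
    have h2 := Finset.single_le_sum (fun m' _ => n₃ d.1 m') (Finset.mem_univ d.2)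
    rw [if_neg e₁] at h1
    rw [if_neg e₂, ind_of hdT] at h2
    linarith

end Decoder

/-- Change of measure: an independent draw of law `w` passes a likelihood ratio test against the
joint law with small probability. -/
theorem sum_mul_sum_ind_le {Ω α β : Type*} [Fintype Ω] [Fintype α] [Fintype β] {J : Ω → ℝ}
    (hJ1 : ∑ ω, J ω = 1) (hJ : ∀ ω, 0 ≤ J ω) (A : Ω → α) (B : Ω → β) (w : β → ℝ)
    (T : β → α → Prop) {θ : ℝ} (hθ : 0 ≤ θ)
    (hT : ∀ v a, T v a → w v * marginal J A a ≤ θ * marginal J (fun ω => (B ω, A ω)) (v, a)) :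
    ∑ v, w v * ∑ ω, J ω * ind (T v (A ω)) ≤ θ := by
  have h : ∀ v, w v * ∑ ω, J ω * ind (T v (A ω)) ≤
      ∑ a, θ * marginal J (fun ω => (B ω, A ω)) (v, a) := fun v => by
    rw [sum_mul_comp_eq_sum_marginal J A fun a => ind (T v a), Finset.mul_sum]
    refine Finset.sum_le_sum fun a _ => ?_
    by_cases ha : T v a
    · rw [ind_of ha, mul_one]; exact hT v a ha
    · rw [ind_of_not ha, mul_zero, mul_zero]
      exact mul_nonneg hθ (marginal_nonneg hJ _ _)
  calc _ ≤ ∑ v, ∑ a, θ * marginal J (fun ω => (B ω, A ω)) (v, a) :=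
        Finset.sum_le_sum fun v _ => h v
    _ = θ := by
      rw [← Fintype.sum_prod_type (f := fun x => θ * marginal J (fun ω => (B ω, A ω)) x),
        ← Finset.mul_sum, sum_marginal, hJ1, mul_one]

theorem sum_sum_sum_rotate {α β γ : Type*} [Fintype α] [Fintype β] [Fintype γ]
    (f : α → β → γ → ℝ) : ∑ a, ∑ b, ∑ c, f a b c = ∑ c, ∑ a, ∑ b, f a b c := by
  rw [Finset.sum_comm]
  simp only [Finset.sum_comm (s := Finset.univ (α := α))]
  rw [Finset.sum_comm]

/-! ### Error analysis under the idealized law -/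

section Decoding

variable {S₁ S₂ Z Y U₁ U₂ ι₁ ι₂ : Type*} [Fintype S₁] [Fintype S₂] [Fintype Z] [Fintype Y]
  {p : S₁ × S₂ × Z → ℝ} {w₁ : U₁ → ℝ} {L₁ : U₁ → S₁ → ℝ} {w₂ : U₂ → ℝ}
  {L₂ : U₂ → S₂ → ℝ} {V : U₁ → S₁ → U₂ → S₂ → Y → ℝ}

/-- The average over sources, side information and channel output for given codewords, with the
sources reweighted by the densities. -/
def tiltedSum (p : S₁ × S₂ × Z → ℝ) (L₁ : U₁ → S₁ → ℝ)
    (L₂ : U₂ → S₂ → ℝ) (V : U₁ → S₁ → U₂ → S₂ → Y → ℝ) (u₁ : U₁) (u₂ : U₂)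
    (f : S₁ × S₂ × Z → Y → ℝ) : ℝ :=
  ∑ s, ∑ y, p s * L₁ u₁ s.1 * L₂ u₂ s.2.1 * V u₁ s.1 u₂ s.2.1 y * f s y

theorem tiltedSum_add (u₁ : U₁) (u₂ : U₂) (f g : S₁ × S₂ × Z → Y → ℝ) :
    tiltedSum p L₁ L₂ V u₁ u₂ (fun s y => f s y + g s y) =
      tiltedSum p L₁ L₂ V u₁ u₂ f + tiltedSum p L₁ L₂ V u₁ u₂ g := by
  simp only [tiltedSum, mul_add, Finset.sum_add_distrib]

theorem tiltedSum_sum_ite {ι : Type*} [Fintype ι] [DecidableEq ι] (u₁ : U₁) (u₂ : U₂) (m : ι)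
    (f : ι → S₁ × S₂ × Z → Y → ℝ) :
    tiltedSum p L₁ L₂ V u₁ u₂ (fun s y => ∑ m', if m' = m then 0 else f m' s y) =
      ∑ m', if m' = m then 0 else tiltedSum p L₁ L₂ V u₁ u₂ (f m') := by
  simp only [tiltedSum, Finset.mul_sum]
  have : ∀ s : S₁ × S₂ × Z, ∑ y, ∑ m', p s * L₁ u₁ s.1 * L₂ u₂ s.2.1 * V u₁ s.1 u₂ s.2.1 y *
      (if m' = m then 0 else f m' s y) = ∑ m', ∑ y, p s * L₁ u₁ s.1 * L₂ u₂ s.2.1 *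
        V u₁ s.1 u₂ s.2.1 y * (if m' = m then 0 else f m' s y) := fun s => Finset.sum_comm
  simp only [this]
  rw [Finset.sum_comm]
  refine Finset.sum_congr rfl fun m' _ => ?_
  split_ifs <;> simp

namespace IsDensityData

variable [Fintype U₁] [Fintype U₂]

theorem tiltedSum_mono (h : IsDensityData p w₁ L₁ w₂ L₂ V) (u₁ : U₁) (u₂ : U₂)
    {f g : S₁ × S₂ × Z → Y → ℝ} (hfg : ∀ s y, f s y ≤ g s y) :
    tiltedSum p L₁ L₂ V u₁ u₂ f ≤ tiltedSum p L₁ L₂ V u₁ u₂ g :=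
  Finset.sum_le_sum fun s _ => Finset.sum_le_sum fun y _ =>
    mul_le_mul_of_nonneg_left (hfg s y) (mul_nonneg (mul_nonneg (mul_nonneg (h.p_nonneg s)
      (h.L₁_nonneg _ _)) (h.L₂_nonneg _ _)) (h.V_nonneg _ _ _ _ _))

theorem tiltedSum_nonneg (h : IsDensityData p w₁ L₁ w₂ L₂ V) (u₁ : U₁) (u₂ : U₂)
    {f : S₁ × S₂ × Z → Y → ℝ} (hf : ∀ s y, 0 ≤ f s y) : 0 ≤ tiltedSum p L₁ L₂ V u₁ u₂ f := by
  refine le_trans (le_of_eq ?_) (h.tiltedSum_mono u₁ u₂ hf)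
  simp [tiltedSum]

variable [Fintype ι₁] [Fintype ι₂] [DecidableEq ι₁] [DecidableEq ι₂] [Nonempty ι₁] [Nonempty ι₂]

/-- Error analysis of the decoder for codewords of uniform index and reweighted sources. -/
theorem sum_codeWeight_testDecoder_le (h : IsDensityData p w₁ L₁ w₂ L₂ V)
    (T : U₁ → U₂ → Y → Z → Prop)
    (Bad : Letter U₁ U₂ S₁ S₂ Z Y → Prop) {θ₁ θ₂ θ₁₂ : ℝ} (hθ₁ : 0 ≤ θ₁) (hθ₂ : 0 ≤ θ₂)
    (hθ₁₂ : 0 ≤ θ₁₂)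
    (hT₁ : ∀ u₁ u₂ y z, T u₁ u₂ y z →
      w₁ u₁ * marginal (densityLaw p w₁ L₁ w₂ L₂ V) (fun ω => (rvU₂ ω, rvY ω, rvZ ω)) (u₂, y, z) ≤
        θ₁ * marginal (densityLaw p w₁ L₁ w₂ L₂ V)
          (fun ω => (rvU₁ ω, rvU₂ ω, rvY ω, rvZ ω)) (u₁, u₂, y, z))
    (hT₂ : ∀ u₁ u₂ y z, T u₁ u₂ y z →
      w₂ u₂ * marginal (densityLaw p w₁ L₁ w₂ L₂ V) (fun ω => (rvU₁ ω, rvY ω, rvZ ω)) (u₁, y, z) ≤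
        θ₂ * marginal (densityLaw p w₁ L₁ w₂ L₂ V)
          (fun ω => (rvU₂ ω, rvU₁ ω, rvY ω, rvZ ω)) (u₂, u₁, y, z))
    (hT₁₂ : ∀ u₁ u₂ y z, T u₁ u₂ y z →
      w₁ u₁ * w₂ u₂ * marginal (densityLaw p w₁ L₁ w₂ L₂ V) (fun ω => (rvY ω, rvZ ω)) (y, z) ≤
        θ₁₂ * marginal (densityLaw p w₁ L₁ w₂ L₂ V)
          (fun ω => ((rvU₁ ω, rvU₂ ω), rvY ω, rvZ ω)) ((u₁, u₂), y, z)) :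
    ∑ a : (ι₁ → U₁) × ι₁, codeWeight w₁ a * ∑ b : (ι₂ → U₂) × ι₂, codeWeight w₂ b *
        tiltedSum p L₁ L₂ V (a.1 a.2) (b.1 b.2) (fun s y =>
          ind (Bad (a.1 (testDecoder T a.1 b.1 y s.2.2).1, b.1 (testDecoder T a.1 b.1 y s.2.2).2,
            s.1, s.2.1, s.2.2, y))) ≤
      ∑ ω, densityLaw p w₁ L₁ w₂ L₂ V ω *
        (ind (Bad ω) + ind (¬T (rvU₁ ω) (rvU₂ ω) (rvY ω) (rvZ ω))) +
      Fintype.card ι₁ * θ₁ + Fintype.card ι₂ * θ₂ +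
      Fintype.card ι₁ * Fintype.card ι₂ * θ₁₂ := by
  set J := densityLaw p w₁ L₁ w₂ L₂ V with hJ
  set G := tiltedSum p L₁ L₂ V with hG
  -- Independent codewords of laws `w₁`, `w₂`, with the source reweighted by both densities, have
  -- exactly the joint law.
  have hGJ : ∀ f : U₁ → U₂ → S₁ × S₂ × Z → Y → ℝ,
      ∑ u₁, w₁ u₁ * ∑ u₂, w₂ u₂ * G u₁ u₂ (f u₁ u₂) =
        ∑ ω, J ω * f (rvU₁ ω) (rvU₂ ω) (rvS₁ ω, rvS₂ ω, rvZ ω) (rvY ω) := fun f => by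
    rw [hJ, sum_densityLaw_mul]; rfl
  have hTn : ∀ v₁ v₂ u₁ u₂, 0 ≤ G u₁ u₂ (fun s y => ind (T v₁ v₂ y s.2.2)) :=
    fun v₁ v₂ u₁ u₂ => h.tiltedSum_nonneg _ _ fun s y => ind_nonneg _
  have hpt : ∀ (a : (ι₁ → U₁) × ι₁) (b : (ι₂ → U₂) × ι₂),
      G (a.1 a.2) (b.1 b.2) (fun s y =>
          ind (Bad (a.1 (testDecoder T a.1 b.1 y s.2.2).1, b.1 (testDecoder T a.1 b.1 y s.2.2).2,
            s.1, s.2.1, s.2.2, y))) ≤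
        G (a.1 a.2) (b.1 b.2) (fun s y => ind (Bad (a.1 a.2, b.1 b.2, s.1, s.2.1, s.2.2, y)) +
          ind (¬T (a.1 a.2) (b.1 b.2) y s.2.2)) +
        (∑ m', if m' = a.2 then 0 else
          G (a.1 a.2) (b.1 b.2) (fun s y => ind (T (a.1 m') (b.1 b.2) y s.2.2))) +
        (∑ m', if m' = b.2 then 0 else
          G (a.1 a.2) (b.1 b.2) (fun s y => ind (T (a.1 a.2) (b.1 m') y s.2.2))) +
        ∑ m', if m' = a.2 then 0 else ∑ m'', if m'' = b.2 then 0 else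
          G (a.1 a.2) (b.1 b.2) (fun s y => ind (T (a.1 m') (b.1 m'') y s.2.2)) := fun a b => by
    refine (h.tiltedSum_mono _ _ fun s y =>
      ind_testDecoder_le T Bad a.1 b.1 a.2 b.2 s.1 s.2.1 s.2.2 y).trans_eq ?_
    rw [tiltedSum_add, tiltedSum_add, tiltedSum_add, tiltedSum_sum_ite, tiltedSum_sum_ite,
      tiltedSum_sum_ite]
    simp only [tiltedSum_sum_ite, ← hG]
  have hw₁0 := fun a : (ι₁ → U₁) × ι₁ => codeWeight_nonneg h.w₁_nonneg a
  have hw₂0 := fun b : (ι₂ → U₂) × ι₂ => codeWeight_nonneg h.w₂_nonneg b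
  have swap : ∀ (a : (ι₁ → U₁) × ι₁) (f : (ι₂ → U₂) × ι₂ → ι₁ → ℝ),
      ∑ b : (ι₂ → U₂) × ι₂, codeWeight w₂ b * (∑ m', if m' = a.2 then 0 else f b m') =
        ∑ m', if m' = a.2 then 0 else ∑ b, codeWeight w₂ b * f b m' := fun a f => by
    simp only [Finset.mul_sum]
    rw [Finset.sum_comm]
    refine Finset.sum_congr rfl fun m' _ => ?_
    split_ifs <;> simp
  have t₀ : ∑ a : (ι₁ → U₁) × ι₁, codeWeight w₁ a * ∑ b : (ι₂ → U₂) × ι₂, codeWeight w₂ b *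
      G (a.1 a.2) (b.1 b.2) (fun s y => ind (Bad (a.1 a.2, b.1 b.2, s.1, s.2.1, s.2.2, y)) +
          ind (¬T (a.1 a.2) (b.1 b.2) y s.2.2)) =
      ∑ ω, J ω * (ind (Bad ω) + ind (¬T (rvU₁ ω) (rvU₂ ω) (rvY ω) (rvZ ω))) := by
    have e : ∀ u₁, ∑ b : (ι₂ → U₂) × ι₂, codeWeight w₂ b *
      G u₁ (b.1 b.2) (fun s y => ind (Bad (u₁, b.1 b.2, s.1, s.2.1, s.2.2, y)) +
          ind (¬T u₁ (b.1 b.2) y s.2.2)) = ∑ u₂, w₂ u₂ *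
      G u₁ u₂ (fun s y => ind (Bad (u₁, u₂, s.1, s.2.1, s.2.2, y)) +
          ind (¬T u₁ u₂ y s.2.2)) := fun u₁ =>
        sum_codeWeight_mul h.w₂_sum fun u₂ => G u₁ u₂
          (fun s y => ind (Bad (u₁, u₂, s.1, s.2.1, s.2.2, y)) + ind (¬T u₁ u₂ y s.2.2))
    simp only [e]
    rw [sum_codeWeight_mul h.w₁_sum fun u₁ => ∑ u₂, w₂ u₂ *
      G u₁ u₂ (fun s y => ind (Bad (u₁, u₂, s.1, s.2.1, s.2.2, y)) + ind (¬T u₁ u₂ y s.2.2)),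
      hGJ fun u₁ u₂ s y => ind (Bad (u₁, u₂, s.1, s.2.1, s.2.2, y)) + ind (¬T u₁ u₂ y s.2.2)]
    rfl
  have t₁ : ∑ a : (ι₁ → U₁) × ι₁, codeWeight w₁ a * ∑ b : (ι₂ → U₂) × ι₂, codeWeight w₂ b *
      (∑ m', if m' = a.2 then 0 else
          G (a.1 a.2) (b.1 b.2) (fun s y => ind (T (a.1 m') (b.1 b.2) y s.2.2))) ≤
      Fintype.card ι₁ * θ₁ := by
    simp only [swap]
    have e : ∀ u v, ∑ b : (ι₂ → U₂) × ι₂, codeWeight w₂ b *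
        G u (b.1 b.2) (fun s y => ind (T v (b.1 b.2) y s.2.2)) =
          ∑ u₂, w₂ u₂ * G u u₂ (fun s y => ind (T v u₂ y s.2.2)) := fun u v =>
      sum_codeWeight_mul h.w₂_sum fun u₂ => G u u₂ (fun s y => ind (T v u₂ y s.2.2))
    simp only [e]
    refine (sum_codeWeight_mul_sum_le h.w₁_nonneg h.w₁_sum
      (F := fun u v => ∑ u₂, w₂ u₂ * G u u₂ (fun s y => ind (T v u₂ y s.2.2)))
      fun u v => Finset.sum_nonneg fun u₂ _ => mul_nonneg (h.w₂_nonneg _) (hTn _ _ _ _)).trans ?_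
    refine mul_le_mul_of_nonneg_left ?_ (Nat.cast_nonneg _)
    refine le_trans (le_of_eq ?_) (sum_mul_sum_ind_le h.law_sum h.law_nonneg
      (fun ω => (rvU₂ ω, rvY ω, rvZ ω)) rvU₁ w₁ (fun v a => T v a.1 a.2.1 a.2.2) hθ₁
      fun v a => hT₁ v a.1 a.2.1 a.2.2)
    -- The competing codeword `v` goes outermost; averaging over the true codewords then restores
    -- the joint law, against which `v` is independent.
    rw [Finset.sum_comm]
    refine Finset.sum_congr rfl fun v _ => ?_
    rw [← hJ, ← hGJ fun _ u₂ s y => ind (T v u₂ y s.2.2), Finset.mul_sum]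
    exact Finset.sum_congr rfl fun u _ => by ring
  have t₂ : ∑ a : (ι₁ → U₁) × ι₁, codeWeight w₁ a * ∑ b : (ι₂ → U₂) × ι₂, codeWeight w₂ b *
      (∑ m', if m' = b.2 then 0 else
          G (a.1 a.2) (b.1 b.2) (fun s y => ind (T (a.1 a.2) (b.1 m') y s.2.2))) ≤
      Fintype.card ι₂ * θ₂ := by
    have e : ∀ u, ∑ b : (ι₂ → U₂) × ι₂, codeWeight w₂ b *
      (∑ m', if m' = b.2 then 0 else G u (b.1 b.2) (fun s y => ind (T u (b.1 m') y s.2.2))) ≤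
        Fintype.card ι₂ * ∑ u₂, ∑ v, w₂ u₂ * w₂ v * G u u₂ (fun s y => ind (T u v y s.2.2)) :=
      fun u => sum_codeWeight_mul_sum_le h.w₂_nonneg h.w₂_sum
        (F := fun u₂ v => G u u₂ (fun s y => ind (T u v y s.2.2))) fun u₂ v => hTn _ _ _ _
    refine (Finset.sum_le_sum fun a _ => mul_le_mul_of_nonneg_left (e (a.1 a.2))
      (hw₁0 a)).trans ?_
    rw [sum_codeWeight_mul h.w₁_sum fun u => Fintype.card ι₂ *
      ∑ u₂, ∑ v, w₂ u₂ * w₂ v * G u u₂ (fun s y => ind (T u v y s.2.2))]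
    have e2 : ∑ u, w₁ u * (Fintype.card ι₂ *
        ∑ u₂, ∑ v, w₂ u₂ * w₂ v * G u u₂ (fun s y => ind (T u v y s.2.2))) =
        Fintype.card ι₂ * ∑ v, w₂ v * ∑ u, w₁ u * ∑ u₂, w₂ u₂ *
          G u u₂ (fun s y => ind (T u v y s.2.2)) := by
      simp only [Finset.mul_sum]
      rw [sum_sum_sum_rotate]
      exact Finset.sum_congr rfl fun _ _ => Finset.sum_congr rfl fun _ _ =>
        Finset.sum_congr rfl fun _ _ => by ring
    rw [e2]
    refine mul_le_mul_of_nonneg_left ?_ (Nat.cast_nonneg _)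
    refine le_trans (le_of_eq ?_) (sum_mul_sum_ind_le h.law_sum h.law_nonneg
      (fun ω => (rvU₁ ω, rvY ω, rvZ ω)) rvU₂ w₂ (fun v a => T a.1 v a.2.1 a.2.2) hθ₂
      fun v a => hT₂ a.1 v a.2.1 a.2.2)
    refine Finset.sum_congr rfl fun v _ => ?_
    rw [← hJ, ← hGJ fun u _ s y => ind (T u v y s.2.2)]
  have t₃ : ∑ a : (ι₁ → U₁) × ι₁, codeWeight w₁ a * ∑ b : (ι₂ → U₂) × ι₂, codeWeight w₂ b *
      (∑ m', if m' = a.2 then 0 else ∑ m'', if m'' = b.2 then 0 else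
          G (a.1 a.2) (b.1 b.2) (fun s y => ind (T (a.1 m') (b.1 m'') y s.2.2))) ≤
      Fintype.card ι₁ * Fintype.card ι₂ * θ₁₂ := by
    simp only [swap]
    -- With both indices wrong the union bound is applied twice: first to the first codebook, with
    -- the whole average over the second codebook as `F`, then to the second.
    refine (sum_codeWeight_mul_sum_le h.w₁_nonneg h.w₁_sum
      (F := fun u v => ∑ b : (ι₂ → U₂) × ι₂, codeWeight w₂ b *
        (∑ m'', if m'' = b.2 then 0 else
          G u (b.1 b.2) (fun s y => ind (T v (b.1 m'') y s.2.2))))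
      fun u v => Finset.sum_nonneg fun b _ => mul_nonneg (hw₂0 _) (Finset.sum_nonneg fun m'' _ => by
        split_ifs <;> [exact le_rfl; exact hTn _ _ _ _])).trans ?_
    rw [mul_assoc]
    refine mul_le_mul_of_nonneg_left ?_ (Nat.cast_nonneg _)
    have e : ∀ u v, ∑ b : (ι₂ → U₂) × ι₂, codeWeight w₂ b *
        (∑ m'', if m'' = b.2 then 0 else
          G u (b.1 b.2) (fun s y => ind (T v (b.1 m'') y s.2.2))) ≤
        Fintype.card ι₂ * ∑ u₂, ∑ v₂, w₂ u₂ * w₂ v₂ * G u u₂ (fun s y => ind (T v v₂ y s.2.2)) :=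
      fun u v => sum_codeWeight_mul_sum_le h.w₂_nonneg h.w₂_sum
        (F := fun u₂ v₂ => G u u₂ (fun s y => ind (T v v₂ y s.2.2))) fun u₂ v₂ => hTn _ _ _ _
    refine (Finset.sum_le_sum fun u _ => Finset.sum_le_sum fun v _ =>
      mul_le_mul_of_nonneg_left (e u v)
        (mul_nonneg (h.w₁_nonneg u) (h.w₁_nonneg v))).trans ?_
    have e2 : ∑ u, ∑ v, w₁ u * w₁ v * (Fintype.card ι₂ *
        ∑ u₂, ∑ v₂, w₂ u₂ * w₂ v₂ * G u u₂ (fun s y => ind (T v v₂ y s.2.2))) =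
        Fintype.card ι₂ * ∑ v : U₁ × U₂, w₁ v.1 * w₂ v.2 * ∑ u, w₁ u * ∑ u₂, w₂ u₂ *
          G u u₂ (fun s y => ind (T v.1 v.2 y s.2.2)) := by
      simp only [Fintype.sum_prod_type, Finset.mul_sum]
      rw [Finset.sum_comm]
      refine Finset.sum_congr rfl fun _ _ => ?_
      rw [sum_sum_sum_rotate]
      exact Finset.sum_congr rfl fun _ _ => Finset.sum_congr rfl fun _ _ =>
        Finset.sum_congr rfl fun _ _ => by ring
    rw [e2]
    refine mul_le_mul_of_nonneg_left ?_ (Nat.cast_nonneg _)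
    refine le_trans (le_of_eq ?_) (sum_mul_sum_ind_le h.law_sum h.law_nonneg
      (fun ω => (rvY ω, rvZ ω)) (fun ω => (rvU₁ ω, rvU₂ ω)) (fun v => w₁ v.1 * w₂ v.2)
      (fun v a => T v.1 v.2 a.1 a.2) hθ₁₂ fun v a => hT₁₂ v.1 v.2 a.1 a.2)
    refine Finset.sum_congr rfl fun v _ => ?_
    rw [← hJ, ← hGJ fun _ _ s y => ind (T v.1 v.2 y s.2.2)]
  refine (Finset.sum_le_sum fun a _ => mul_le_mul_of_nonneg_left (Finset.sum_le_sum fun b _ =>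
    mul_le_mul_of_nonneg_left (hpt a b) (hw₂0 b)) (hw₁0 a)).trans ?_
  simp only [mul_add, Finset.sum_add_distrib] at t₀ ⊢
  linarith

end IsDensityData

end Decoding

/-! ### Derandomization: a one-shot deterministic code -/

section OneShotCode

variable {S₁ S₂ Z Y U₁ U₂ ι₁ ι₂ : Type*} [Fintype S₁] [Fintype S₂] [Fintype Z] [Fintype Y]
  [Fintype U₁] [Fintype U₂] [Fintype ι₁] [Fintype ι₂]

/-- Deterministic selections do at least as well as randomized ones. -/
theorem exists_sum_le_sum_kernel {α ι : Type*} [Fintype α] [Fintype ι] {K : α → ι → ℝ}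
    (hK : ∀ s m, 0 ≤ K s m) (hK1 : ∀ s, ∑ m, K s m = 1) (G : α → ι → ℝ) :
    ∃ f : α → ι, ∑ s, G s (f s) ≤ ∑ s, ∑ m, K s m * G s m := by
  choose f hf using fun s =>
    exists_le_of_weighted_sum_le (hK s) (hK1 s) (le_refl (∑ m, K s m * G s m))
  exact ⟨f, Finset.sum_le_sum fun s _ => hf s⟩

/-- Deterministic choices for two separate encoders. -/
theorem exists_sum_le_sum_kernel_kernel {K₁ : S₁ → ι₁ → ℝ} {K₂ : S₂ → ι₂ → ℝ}
    (hK₁ : ∀ s m, 0 ≤ K₁ s m) (hK₁1 : ∀ s, ∑ m, K₁ s m = 1)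
    (hK₂ : ∀ s m, 0 ≤ K₂ s m) (hK₂1 : ∀ s, ∑ m, K₂ s m = 1)
    (G : S₁ × S₂ × Z → ι₁ → ι₂ → ℝ) :
    ∃ (f₁ : S₁ → ι₁) (f₂ : S₂ → ι₂), ∑ s, G s (f₁ s.1) (f₂ s.2.1) ≤
      ∑ s : S₁ × S₂ × Z, ∑ m₁, ∑ m₂, K₁ s.1 m₁ * K₂ s.2.1 m₂ * G s m₁ m₂ := by
  -- The cost is linear in each kernel, so averaging over everything but `s₁` leaves a cost of `(s₁,
  -- m₁)` alone, and the best index may be chosen for each `s₁`. The second encoder is then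
  -- optimized with the first one fixed, so each still sees only its own source.
  obtain ⟨f₁, hf₁⟩ := exists_sum_le_sum_kernel hK₁ hK₁1 fun s₁ m₁ =>
    ∑ s' : S₂ × Z, ∑ m₂, K₂ s'.1 m₂ * G (s₁, s') m₁ m₂
  obtain ⟨f₂, hf₂⟩ := exists_sum_le_sum_kernel hK₂ hK₂1 fun s₂ m₂ =>
    ∑ s₁, ∑ z, G (s₁, s₂, z) (f₁ s₁) m₂
  refine ⟨f₁, f₂, ?_⟩
  calc ∑ s : S₁ × S₂ × Z, G s (f₁ s.1) (f₂ s.2.1)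
      = ∑ s₂, ∑ s₁, ∑ z, G (s₁, s₂, z) (f₁ s₁) (f₂ s₂) := by
        simp only [Fintype.sum_prod_type]; rw [Finset.sum_comm]
    _ ≤ _ := hf₂
    _ = ∑ s₁, ∑ s' : S₂ × Z, ∑ m₂, K₂ s'.1 m₂ * G (s₁, s') (f₁ s₁) m₂ := by
        simp only [Fintype.sum_prod_type, Finset.mul_sum]
        rw [Finset.sum_comm (s := Finset.univ (α := S₁))]
        refine Finset.sum_congr rfl fun s₂ _ => ?_
        rw [Finset.sum_comm]
        refine Finset.sum_congr rfl fun s₁ _ => ?_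
        rw [Finset.sum_comm]
    _ ≤ _ := hf₁
    _ = _ := by
        rw [Fintype.sum_prod_type (γ := ℝ) (f := fun s : S₁ × S₂ × Z =>
          ∑ m₁, ∑ m₂, K₁ s.1 m₁ * K₂ s.2.1 m₂ * G s m₁ m₂)]
        refine Finset.sum_congr rfl fun s₁ _ => ?_
        simp only [Finset.mul_sum]
        rw [Finset.sum_comm]
        refine Finset.sum_congr rfl fun _ _ => Finset.sum_congr rfl fun _ _ =>
          Finset.sum_congr rfl fun _ _ => by ring

variable {p : S₁ × S₂ × Z → ℝ} {w₁ : U₁ → ℝ} {L₁ : U₁ → S₁ → ℝ} {w₂ : U₂ → ℝ}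
  {L₂ : U₂ → S₂ → ℝ} {V : U₁ → S₁ → U₂ → S₂ → Y → ℝ}

/-- One-shot hybrid coding: there are deterministic encoders and a decoder such that the decoded
auxiliary symbols fall into `Bad` with small probability. The test `T` used by the decoder
bounds likelihood ratios. -/
theorem IsDensityData.exists_code (h : IsDensityData p w₁ L₁ w₂ L₂ V)
    [DecidableEq ι₁] [DecidableEq ι₂] [Nonempty ι₁] [Nonempty ι₂]
    {τ₁ c₁ τ₂ c₂ : ℝ} (hc₁ : 0 < c₁) (hτ₁0 : 0 ≤ τ₁) (hτ₁ : τ₁ ≤ c₁ ^ 2 * Fintype.card ι₁)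
    (hc₂ : 0 < c₂) (hτ₂0 : 0 ≤ τ₂) (hτ₂ : τ₂ ≤ c₂ ^ 2 * Fintype.card ι₂)
    (T : U₁ → U₂ → Y → Z → Prop)
    (Bad : Letter U₁ U₂ S₁ S₂ Z Y → Prop) {θ₁ θ₂ θ₁₂ : ℝ} (hθ₁ : 0 ≤ θ₁) (hθ₂ : 0 ≤ θ₂)
    (hθ₁₂ : 0 ≤ θ₁₂)
    (hT₁ : ∀ u₁ u₂ y z, T u₁ u₂ y z →
      w₁ u₁ * marginal (densityLaw p w₁ L₁ w₂ L₂ V) (fun ω => (rvU₂ ω, rvY ω, rvZ ω)) (u₂, y, z) ≤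
        θ₁ * marginal (densityLaw p w₁ L₁ w₂ L₂ V)
          (fun ω => (rvU₁ ω, rvU₂ ω, rvY ω, rvZ ω)) (u₁, u₂, y, z))
    (hT₂ : ∀ u₁ u₂ y z, T u₁ u₂ y z →
      w₂ u₂ * marginal (densityLaw p w₁ L₁ w₂ L₂ V) (fun ω => (rvU₁ ω, rvY ω, rvZ ω)) (u₁, y, z) ≤
        θ₂ * marginal (densityLaw p w₁ L₁ w₂ L₂ V)
          (fun ω => (rvU₂ ω, rvU₁ ω, rvY ω, rvZ ω)) (u₂, u₁, y, z))
    (hT₁₂ : ∀ u₁ u₂ y z, T u₁ u₂ y z →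
      w₁ u₁ * w₂ u₂ * marginal (densityLaw p w₁ L₁ w₂ L₂ V) (fun ω => (rvY ω, rvZ ω)) (y, z) ≤
        θ₁₂ * marginal (densityLaw p w₁ L₁ w₂ L₂ V)
          (fun ω => ((rvU₁ ω, rvU₂ ω), rvY ω, rvZ ω)) ((u₁, u₂), y, z)) :
    ∃ (e₁ : S₁ → U₁) (e₂ : S₂ → U₂) (φ : Y → Z → U₁ × U₂),
      ∑ s : S₁ × S₂ × Z, ∑ y, p s * V (e₁ s.1) s.1 (e₂ s.2.1) s.2.1 y *
          ind (Bad ((φ y s.2.2).1, (φ y s.2.2).2, s.1, s.2.1, s.2.2, y)) ≤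
        (∑ ω, densityLaw p w₁ L₁ w₂ L₂ V ω *
          (ind (Bad ω) + ind (¬T (rvU₁ ω) (rvU₂ ω) (rvY ω) (rvZ ω))) +
        Fintype.card ι₁ * θ₁ + Fintype.card ι₂ * θ₂ +
        Fintype.card ι₁ * Fintype.card ι₂ * θ₁₂) +
      (2 * (∑ ω, densityLaw p w₁ L₁ w₂ L₂ V ω * ind (τ₁ < L₁ (rvU₁ ω) (rvS₁ ω))) + c₁) +
      (2 * (∑ ω, densityLaw p w₁ L₁ w₂ L₂ V ω * ind (τ₂ < L₂ (rvU₂ ω) (rvS₂ ω))) + c₂) := by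
  set F : S₁ × S₂ × Z → (ι₁ → U₁) × ι₁ → (ι₂ → U₂) × ι₂ → ℝ := fun s a b =>
    ∑ y, V (a.1 a.2) s.1 (b.1 b.2) s.2.1 y *
      ind (Bad (a.1 (testDecoder T a.1 b.1 y s.2.2).1, b.1 (testDecoder T a.1 b.1 y s.2.2).2,
            s.1, s.2.1, s.2.2, y)) with hF
  have hF0 : ∀ s a b, 0 ≤ F s a b := fun s a b => Finset.sum_nonneg fun y _ =>
    mul_nonneg (h.V_nonneg _ _ _ _ _) (ind_nonneg _)
  have hF1 : ∀ s a b, F s a b ≤ 1 := fun s a b => by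
    rw [← h.V_sum (a.1 a.2) s.1 (b.1 b.2) s.2.1]
    exact Finset.sum_le_sum fun y _ => mul_le_of_le_one_right (h.V_nonneg _ _ _ _ _) (ind_le_one _)
  have key := h.sum_likelihoodEncoder_le (ι₁ := ι₁) (ι₂ := ι₂) hc₁ hτ₁0 hτ₁ hc₂ hτ₂0 hτ₂ hF0 hF1
  have dec := h.sum_codeWeight_testDecoder_le (ι₁ := ι₁) (ι₂ := ι₂) T Bad hθ₁ hθ₂ hθ₁₂ hT₁ hT₂ hT₁₂
  have e₀ : ∑ s, p s * (∑ a : (ι₁ → U₁) × ι₁, ∑ b : (ι₂ → U₂) × ι₂,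
        codeWeight w₁ a * L₁ (a.1 a.2) s.1 * (codeWeight w₂ b * L₂ (b.1 b.2) s.2.1) * F s a b) =
      ∑ a : (ι₁ → U₁) × ι₁, codeWeight w₁ a * ∑ b : (ι₂ → U₂) × ι₂, codeWeight w₂ b *
        tiltedSum p L₁ L₂ V (a.1 a.2) (b.1 b.2) (fun s y =>
          ind (Bad (a.1 (testDecoder T a.1 b.1 y s.2.2).1, b.1 (testDecoder T a.1 b.1 y s.2.2).2,
            s.1, s.2.1, s.2.2, y))) := by
    simp only [Finset.mul_sum, tiltedSum, hF]
    rw [← sum_sum_sum_rotate]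
    exact Finset.sum_congr rfl fun _ _ => Finset.sum_congr rfl fun _ _ =>
      Finset.sum_congr rfl fun _ _ => Finset.sum_congr rfl fun _ _ => by ring
  rw [← e₀] at dec
  have tot := key.trans (add_le_add (add_le_add dec le_rfl) le_rfl)
  set R := (∑ ω, densityLaw p w₁ L₁ w₂ L₂ V ω *
          (ind (Bad ω) + ind (¬T (rvU₁ ω) (rvU₂ ω) (rvY ω) (rvZ ω))) +
        Fintype.card ι₁ * θ₁ + Fintype.card ι₂ * θ₂ +
        Fintype.card ι₁ * Fintype.card ι₂ * θ₁₂) +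
      (2 * (∑ ω, densityLaw p w₁ L₁ w₂ L₂ V ω * ind (τ₁ < L₁ (rvU₁ ω) (rvS₁ ω))) + c₁) +
      (2 * (∑ ω, densityLaw p w₁ L₁ w₂ L₂ V ω * ind (τ₂ < L₂ (rvU₂ ω) (rvS₂ ω))) + c₂)
  have e₁ : ∑ s, p s * ∑ a : (ι₁ → U₁) × ι₁, ∑ b : (ι₂ → U₂) × ι₂,
        iid ι₁ w₁ a.1 * likelihoodEncoder L₁ a.1 s.1 a.2 *
          (iid ι₂ w₂ b.1 * likelihoodEncoder L₂ b.1 s.2.1 b.2) * F s a b =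
      ∑ C₁ : ι₁ → U₁, iid ι₁ w₁ C₁ * ∑ C₂ : ι₂ → U₂, iid ι₂ w₂ C₂ *
        ∑ s : S₁ × S₂ × Z, ∑ m₁, ∑ m₂, likelihoodEncoder L₁ C₁ s.1 m₁ *
          likelihoodEncoder L₂ C₂ s.2.1 m₂ * (p s * F s (C₁, m₁) (C₂, m₂)) := by
    simp only [Finset.mul_sum]
    rw [← sum_sum_sum_rotate]
    rw [Fintype.sum_prod_type]
    refine Finset.sum_congr rfl fun C₁ _ => ?_
    simp only [Fintype.sum_prod_type (α₁ := ι₂ → U₂)]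
    rw [Finset.sum_comm]
    refine Finset.sum_congr rfl fun C₂ _ => ?_
    rw [sum_sum_sum_rotate]
    exact Finset.sum_congr rfl fun _ _ => Finset.sum_congr rfl fun _ _ =>
      Finset.sum_congr rfl fun _ _ => by ring
  rw [e₁] at tot
  -- The bound holds on average over the codebooks, hence for some pair of them.
  obtain ⟨C₁, hC₁⟩ := exists_le_of_weighted_sum_le (iid_nonneg h.w₁_nonneg) (sum_iid h.w₁_sum) tot
  obtain ⟨C₂, hC₂⟩ := exists_le_of_weighted_sum_le (iid_nonneg h.w₂_nonneg) (sum_iid h.w₂_sum) hC₁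
  obtain ⟨f₁, f₂, hf⟩ := exists_sum_le_sum_kernel_kernel
    (likelihoodEncoder_nonneg h.L₁_nonneg C₁) (sum_likelihoodEncoder L₁ C₁)
    (likelihoodEncoder_nonneg h.L₂_nonneg C₂) (sum_likelihoodEncoder L₂ C₂)
    fun s m₁ m₂ => p s * F s (C₁, m₁) (C₂, m₂)
  refine ⟨fun s => C₁ (f₁ s), fun s => C₂ (f₂ s), fun y z =>
    (C₁ (testDecoder T C₁ C₂ y z).1, C₂ (testDecoder T C₁ C₂ y z).2),
    le_trans (le_of_eq ?_) (hf.trans hC₂)⟩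
  simp only [hF, Finset.mul_sum, mul_assoc]

end OneShotCode

/-! ### Blocks as one-shot letters over product alphabets -/

section Blocks

variable {S₁ S₂ Z Y U₁ U₂ : Type*} {n : ℕ}

/-- Splitting a block of letters into the blocks of its components. -/
def letterBlockEquiv (n : ℕ) (U₁ U₂ S₁ S₂ Z Y : Type*) :
    (Fin n → Letter U₁ U₂ S₁ S₂ Z Y) ≃
      Letter (Fin n → U₁) (Fin n → U₂) (Fin n → S₁) (Fin n → S₂) (Fin n → Z) (Fin n → Y) where
  toFun ω := (fun i => rvU₁ (ω i), fun i => rvU₂ (ω i), fun i => rvS₁ (ω i), fun i => rvS₂ (ω i),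
    fun i => rvZ (ω i), fun i => rvY (ω i))
  invFun t i := (rvU₁ t i, rvU₂ t i, rvS₁ t i, rvS₂ t i, rvZ t i, rvY t i)
  left_inv _ := rfl
  right_inv _ := rfl

/-- Splitting a block of source letters into the blocks of its components. -/
def sourceBlockEquiv (n : ℕ) (S₁ S₂ Z : Type*) :
    (Fin n → S₁ × S₂ × Z) ≃ (Fin n → S₁) × (Fin n → S₂) × (Fin n → Z) where
  toFun s := (fun i => (s i).1, fun i => (s i).2.1, fun i => (s i).2.2)
  invFun t i := (t.1 i, t.2.1 i, t.2.2 i)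
  left_inv _ := rfl
  right_inv _ := rfl

/-- The source law of a block of letters. -/
def blockSource (n : ℕ) (p : S₁ × S₂ × Z → ℝ) :
    (Fin n → S₁) × (Fin n → S₂) × (Fin n → Z) → ℝ :=
  fun s => ∏ i, p (s.1 i, s.2.1 i, s.2.2 i)

/-- The density of a block of letters. -/
def blockDensity {U S : Type*} (n : ℕ) (L : U → S → ℝ) (u : Fin n → U) (s : Fin n → S) : ℝ :=
  ∏ i, L (u i) (s i)

/-- The channel from auxiliary and source blocks to output blocks. -/
def blockChannel (n : ℕ) (V : U₁ → S₁ → U₂ → S₂ → Y → ℝ) (u₁ : Fin n → U₁) (s₁ : Fin n → S₁)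
    (u₂ : Fin n → U₂) (s₂ : Fin n → S₂) (y : Fin n → Y) : ℝ :=
  ∏ i, V (u₁ i) (s₁ i) (u₂ i) (s₂ i) (y i)

/-- The joint law of blocks of letters. -/
abbrev blockDensityLaw (n : ℕ) (p : S₁ × S₂ × Z → ℝ) (w₁ : U₁ → ℝ) (L₁ : U₁ → S₁ → ℝ)
    (w₂ : U₂ → ℝ) (L₂ : U₂ → S₂ → ℝ) (V : U₁ → S₁ → U₂ → S₂ → Y → ℝ) :
    Letter (Fin n → U₁) (Fin n → U₂) (Fin n → S₁) (Fin n → S₂) (Fin n → Z) (Fin n → Y) → ℝ :=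
  densityLaw (blockSource n p) (iid (Fin n) w₁) (blockDensity n L₁) (iid (Fin n) w₂)
    (blockDensity n L₂) (blockChannel n V)

variable {p : S₁ × S₂ × Z → ℝ} {w₁ : U₁ → ℝ} {L₁ : U₁ → S₁ → ℝ} {w₂ : U₂ → ℝ}
  {L₂ : U₂ → S₂ → ℝ} {V : U₁ → S₁ → U₂ → S₂ → Y → ℝ}

theorem blockDensityLaw_letterBlockEquiv (ω : Fin n → Letter U₁ U₂ S₁ S₂ Z Y) :
    blockDensityLaw n p w₁ L₁ w₂ L₂ V (letterBlockEquiv n _ _ _ _ _ _ ω) =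
      iid (Fin n) (densityLaw p w₁ L₁ w₂ L₂ V) ω := by
  simp only [blockDensityLaw, densityLaw, letterBlockEquiv, blockSource, iid,
    blockDensity, blockChannel, ← Finset.prod_mul_distrib]
  rfl

variable [Fintype S₁] [Fintype S₂] [Fintype Z] [Fintype Y] [Fintype U₁] [Fintype U₂]

theorem sum_blockDensityLaw_mul
    (H : Letter (Fin n → U₁) (Fin n → U₂) (Fin n → S₁) (Fin n → S₂) (Fin n → Z) (Fin n → Y) → ℝ) :
    ∑ t, blockDensityLaw n p w₁ L₁ w₂ L₂ V t * H t =
      ∑ ω, iid (Fin n) (densityLaw p w₁ L₁ w₂ L₂ V) ω * H (letterBlockEquiv n _ _ _ _ _ _ ω) := by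
  rw [← (letterBlockEquiv n U₁ U₂ S₁ S₂ Z Y).sum_comp]
  simp only [blockDensityLaw_letterBlockEquiv]

/-- The hypothesis is an equivalence of events because `A` is a tuple of blocks while `B` applied
letterwise is a block of tuples. -/
theorem marginal_blockDensityLaw {α β : Type*} {A : Letter (Fin n → U₁) (Fin n → U₂)
      (Fin n → S₁) (Fin n → S₂) (Fin n → Z) (Fin n → Y) → α} {a : α}
    {B : Letter U₁ U₂ S₁ S₂ Z Y → β} {b : Fin n → β}
    (hAB : ∀ ω, A (letterBlockEquiv n _ _ _ _ _ _ ω) = a ↔ (fun i => B (ω i)) = b) :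
    marginal (blockDensityLaw n p w₁ L₁ w₂ L₂ V) A a =
      ∏ i, marginal (densityLaw p w₁ L₁ w₂ L₂ V) B (b i) := by
  classical
  rw [← marginal_iid]
  simp only [marginal]
  rw [← (letterBlockEquiv n U₁ U₂ S₁ S₂ Z Y).sum_comp]
  refine Finset.sum_congr rfl fun ω _ => ?_
  rw [blockDensityLaw_letterBlockEquiv]
  by_cases hω : (fun i => B (ω i)) = b
  · rw [if_pos ((hAB ω).2 hω), if_pos hω]
  · rw [if_neg (mt (hAB ω).1 hω), if_neg hω]

theorem IsDensityData.block (h : IsDensityData p w₁ L₁ w₂ L₂ V) (n : ℕ) :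
    IsDensityData (blockSource n p) (iid (Fin n) w₁) (blockDensity n L₁) (iid (Fin n) w₂)
      (blockDensity n L₂) (blockChannel n V) where
  p_nonneg _ := Finset.prod_nonneg fun _ _ => h.p_nonneg _
  p_sum := by
    rw [← (sourceBlockEquiv n S₁ S₂ Z).sum_comp]
    exact sum_iid h.p_sum
  w₁_nonneg := iid_nonneg h.w₁_nonneg
  w₁_sum := sum_iid h.w₁_sum
  w₂_nonneg := iid_nonneg h.w₂_nonneg
  w₂_sum := sum_iid h.w₂_sum
  L₁_nonneg _ _ := Finset.prod_nonneg fun _ _ => h.L₁_nonneg _ _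
  L₁_sum s := by
    simp only [iid, blockDensity, ← Finset.prod_mul_distrib]
    rw [sum_prod_apply fun i u => w₁ u * L₁ u (s i)]
    simp [h.L₁_sum]
  L₂_nonneg _ _ := Finset.prod_nonneg fun _ _ => h.L₂_nonneg _ _
  L₂_sum s := by
    simp only [iid, blockDensity, ← Finset.prod_mul_distrib]
    rw [sum_prod_apply fun i u => w₂ u * L₂ u (s i)]
    simp [h.L₂_sum]
  V_nonneg _ _ _ _ _ := Finset.prod_nonneg fun _ _ => h.V_nonneg _ _ _ _ _
  V_sum u₁ s₁ u₂ s₂ := by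
    simp only [blockChannel]
    rw [sum_prod_apply fun i y => V (u₁ i) (s₁ i) (u₂ i) (s₂ i) y]
    simp [h.V_sum]

end Blocks

/-! ### Deviation probabilities of empirical means -/

section Deviation

/-- The probability that the empirical mean of `f` deviates by at least `δ` from its
expectation. -/
def deviation {Ω : Type*} [Fintype Ω] (P : Ω → ℝ) (f : Ω → ℝ) (δ : ℝ) (n : ℕ) : ℝ :=
  ∑ ω : Fin n → Ω, iid (Fin n) P ω * ind (n * δ ≤ |∑ i, f (ω i) - n * expect P f|)

theorem tendsto_deviation {Ω : Type*} [Fintype Ω] {P : Ω → ℝ} (hP : ∀ ω, 0 ≤ P ω)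
    (hP1 : ∑ ω, P ω = 1) (f : Ω → ℝ) {δ : ℝ} (hδ : 0 < δ) :
    Filter.Tendsto (deviation P f δ) Filter.atTop (nhds 0) :=
  tendsto_sum_iid_deviation hP hP1 f hδ

/-- The event need only be compared on the support of the product law: elsewhere the logarithms may
be applied to zero and carry no information. -/
theorem sum_iid_ind_le_deviation {Ω : Type*} [Fintype Ω] {P : Ω → ℝ} (hP : ∀ ω, 0 ≤ P ω)
    (f : Ω → ℝ) (δ : ℝ) (n : ℕ) {E : (Fin n → Ω) → Prop}
    (hE : ∀ ω, (∀ i, 0 < P (ω i)) → E ω → n * δ ≤ |∑ i, f (ω i) - n * expect P f|) :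
    ∑ ω, iid (Fin n) P ω * ind (E ω) ≤ deviation P f δ n := by
  refine Finset.sum_le_sum fun ω _ => ?_
  by_cases hω : ∀ i, 0 < P (ω i)
  · exact mul_le_mul_of_nonneg_left (ind_mono (hE ω hω)) (iid_nonneg hP ω)
  · push Not at hω
    obtain ⟨i, hi⟩ := hω
    have : iid (Fin n) P ω = 0 :=
      Finset.prod_eq_zero (Finset.mem_univ i) (le_antisymm hi (hP _))
    simp [this]

theorem le_abs_of_exp_lt_prod {n : ℕ} {a : Fin n → ℝ} (ha : ∀ i, 0 < a i) {μ δ : ℝ}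
    (h : Real.exp (n * (μ + δ)) < ∏ i, a i) :
    n * δ ≤ |∑ i, Real.log (a i) - n * μ| := by
  rw [← Real.log_prod fun i _ => (ha i).ne']
  have := (Real.lt_log_iff_exp_lt (Finset.prod_pos fun i _ => ha i)).2 h
  exact le_trans (by linarith) (le_abs_self _)

theorem le_abs_of_prod_lt_exp {n : ℕ} {a : Fin n → ℝ} (ha : ∀ i, 0 < a i) {μ δ : ℝ}
    (h : ∏ i, a i < Real.exp (n * (μ - δ))) :
    n * δ ≤ |∑ i, Real.log (a i) - n * μ| := by
  rw [← Real.log_prod fun i _ => (ha i).ne']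
  have := (Real.log_lt_iff_lt_exp (Finset.prod_pos fun i _ => ha i)).2 h
  exact le_trans (by linarith) (neg_le_abs _)

theorem le_abs_of_likelihood_ratio_lt {n : ℕ} {Q w R : Fin n → ℝ} (hQ : ∀ i, 0 < Q i)
    (hw : ∀ i, 0 < w i) (hR : ∀ i, 0 < R i) {μ δ : ℝ}
    (h : Real.exp (-(n * (μ - δ))) * ∏ i, Q i < (∏ i, w i) * ∏ i, R i) :
    n * δ ≤ |∑ i, Real.log (Q i / (w i * R i)) - n * μ| := by
  refine le_abs_of_prod_lt_exp (fun i => div_pos (hQ i) (mul_pos (hw i) (hR i))) ?_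
  rw [Finset.prod_div_distrib, Finset.prod_mul_distrib, div_lt_iff₀ (mul_pos
    (Finset.prod_pos fun i _ => hw i) (Finset.prod_pos fun i _ => hR i))]
  rw [Real.exp_neg, inv_mul_lt_iff₀ (Real.exp_pos _)] at h
  exact h

end Deviation

/-! ### Block codes: choice of rates and thresholds -/

section Asymptotics

variable {S₁ S₂ Z Y U₁ U₂ : Type*} [Fintype S₁] [Fintype S₂] [Fintype Z] [Fintype Y]
  [Fintype U₁] [Fintype U₂]
  {p : S₁ × S₂ × Z → ℝ} {w₁ : U₁ → ℝ} {L₁ : U₁ → S₁ → ℝ} {w₂ : U₂ → ℝ}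
  {L₂ : U₂ → S₂ → ℝ} {V : U₁ → S₁ → U₂ → S₂ → Y → ℝ}

/-- Nonnegativity of relative entropy, from `log x ≥ 1 - 1/x`. It makes the codebook exponents
nonnegative, so that rounding up a codebook size costs at most a factor two. -/
theorem sum_mul_mul_log_nonneg {U : Type*} [Fintype U] {w L : U → ℝ} (hw : ∀ u, 0 ≤ w u)
    (hw1 : ∑ u, w u = 1) (hL : ∀ u, 0 ≤ L u) (hL1 : ∑ u, w u * L u = 1) :
    0 ≤ ∑ u, w u * L u * Real.log (L u) := by
  have h : ∀ u, w u * L u - w u ≤ w u * L u * Real.log (L u) := fun u => by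
    rcases (hL u).eq_or_lt with h0 | h0
    · rw [← h0]; simp [hw u]
    · have h1 := Real.one_sub_inv_le_log_of_pos h0
      have h2 := mul_le_mul_of_nonneg_left h1 (mul_nonneg (hw u) h0.le)
      refine le_trans (le_of_eq ?_) h2
      field_simp
  calc (0 : ℝ) = ∑ u, (w u * L u - w u) := by rw [Finset.sum_sub_distrib, hw1, hL1, sub_self]
    _ ≤ _ := Finset.sum_le_sum fun u _ => h u

theorem IsDensityData.expect_log_nonneg₁ (h : IsDensityData p w₁ L₁ w₂ L₂ V) :
    0 ≤ expect (densityLaw p w₁ L₁ w₂ L₂ V) (fun ω => Real.log (L₁ (rvU₁ ω) (rvS₁ ω))) := by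
  unfold expect
  rw [h.sum_law_mul₁ fun u s => Real.log (L₁ u s)]
  exact Finset.sum_nonneg fun s _ => mul_nonneg (h.p_nonneg s)
    (sum_mul_mul_log_nonneg h.w₁_nonneg h.w₁_sum (fun u => h.L₁_nonneg u _) (h.L₁_sum _))

theorem IsDensityData.expect_log_nonneg₂ (h : IsDensityData p w₁ L₁ w₂ L₂ V) :
    0 ≤ expect (densityLaw p w₁ L₁ w₂ L₂ V) (fun ω => Real.log (L₂ (rvU₂ ω) (rvS₂ ω))) := by
  unfold expect
  rw [h.sum_law_mul₂ fun u s => Real.log (L₂ u s)]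
  exact Finset.sum_nonneg fun s _ => mul_nonneg (h.p_nonneg s)
    (sum_mul_mul_log_nonneg h.w₂_nonneg h.w₂_sum (fun u => h.L₂_nonneg u _) (h.L₂_sum _))

theorem IsDensityData.pos_of_law_pos (h : IsDensityData p w₁ L₁ w₂ L₂ V)
    {ω : Letter U₁ U₂ S₁ S₂ Z Y} (hω : 0 < densityLaw p w₁ L₁ w₂ L₂ V ω) :
    0 < w₁ (rvU₁ ω) ∧ 0 < L₁ (rvU₁ ω) (rvS₁ ω) ∧ 0 < w₂ (rvU₂ ω) ∧
      0 < L₂ (rvU₂ ω) (rvS₂ ω) := by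
  obtain ⟨u₁, u₂, s₁, s₂, z, y⟩ := ω
  simp only [densityLaw] at hω
  refine ⟨(h.w₁_nonneg _).lt_of_ne' fun h0 => ?_, (h.L₁_nonneg _ _).lt_of_ne' fun h0 => ?_,
    (h.w₂_nonneg _).lt_of_ne' fun h0 => ?_, (h.L₂_nonneg _ _).lt_of_ne' fun h0 => ?_⟩ <;>
  · simp only [rvU₁, rvU₂, rvS₁, rvS₂] at h0
    simp [h0] at hω

/-- The information density of `U₁` and `(U₂, Y, Z)`. -/
def infoDensity₁ (P : Letter U₁ U₂ S₁ S₂ Z Y → ℝ) (w₁ : U₁ → ℝ) (ω : Letter U₁ U₂ S₁ S₂ Z Y) : ℝ :=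
  Real.log (marginal P (fun ω => (rvU₁ ω, rvU₂ ω, rvY ω, rvZ ω))
      (rvU₁ ω, rvU₂ ω, rvY ω, rvZ ω) /
    (w₁ (rvU₁ ω) * marginal P (fun ω => (rvU₂ ω, rvY ω, rvZ ω)) (rvU₂ ω, rvY ω, rvZ ω)))

/-- The information density of `U₂` and `(U₁, Y, Z)`. -/
def infoDensity₂ (P : Letter U₁ U₂ S₁ S₂ Z Y → ℝ) (w₂ : U₂ → ℝ) (ω : Letter U₁ U₂ S₁ S₂ Z Y) : ℝ :=
  Real.log (marginal P (fun ω => (rvU₂ ω, rvU₁ ω, rvY ω, rvZ ω))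
      (rvU₂ ω, rvU₁ ω, rvY ω, rvZ ω) /
    (w₂ (rvU₂ ω) * marginal P (fun ω => (rvU₁ ω, rvY ω, rvZ ω)) (rvU₁ ω, rvY ω, rvZ ω)))

/-- The multivariate information density of `U₁`, `U₂` and `(Y, Z)`. -/
def infoDensity₁₂ (P : Letter U₁ U₂ S₁ S₂ Z Y → ℝ) (w₁ : U₁ → ℝ) (w₂ : U₂ → ℝ)
    (ω : Letter U₁ U₂ S₁ S₂ Z Y) : ℝ :=
  Real.log (marginal P (fun ω => ((rvU₁ ω, rvU₂ ω), rvY ω, rvZ ω))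
      ((rvU₁ ω, rvU₂ ω), rvY ω, rvZ ω) /
    (w₁ (rvU₁ ω) * w₂ (rvU₂ ω) * marginal P (fun ω => (rvY ω, rvZ ω)) (rvY ω, rvZ ω)))

/-- Block codes in terms of deviation probabilities. -/
theorem IsDensityData.exists_block_code (h : IsDensityData p w₁ L₁ w₂ L₂ V) {n : ℕ} {δ : ℝ}
    (hδ : 0 < δ) {P : Letter U₁ U₂ S₁ S₂ Z Y → ℝ} (hP : P = densityLaw p w₁ L₁ w₂ L₂ V)
    {i₁ i₂ k₁ k₂ k₁₂ : ℝ}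
    (hi₁ : i₁ = expect P fun ω => Real.log (L₁ (rvU₁ ω) (rvS₁ ω)))
    (hi₂ : i₂ = expect P fun ω => Real.log (L₂ (rvU₂ ω) (rvS₂ ω)))
    (hk₁ : k₁ = expect P (infoDensity₁ P w₁))
    (hk₂ : k₂ = expect P (infoDensity₂ P w₂))
    (hk₁₂ : k₁₂ = expect P (infoDensity₁₂ P w₁ w₂))
    (h₁ : i₁ + 4 * δ ≤ k₁) (h₂ : i₂ + 4 * δ ≤ k₂) (h₁₂ : i₁ + i₂ + 6 * δ ≤ k₁₂)
    (Bad : Letter (Fin n → U₁) (Fin n → U₂) (Fin n → S₁) (Fin n → S₂) (Fin n → Z)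
      (Fin n → Y) → Prop) :
    ∃ (e₁ : (Fin n → S₁) → (Fin n → U₁)) (e₂ : (Fin n → S₂) → (Fin n → U₂))
      (φ : (Fin n → Y) → (Fin n → Z) → (Fin n → U₁) × (Fin n → U₂)),
      ∑ s : (Fin n → S₁) × (Fin n → S₂) × (Fin n → Z), ∑ y,
          blockSource n p s * blockChannel n V (e₁ s.1) s.1 (e₂ s.2.1) s.2.1 y *
          ind (Bad ((φ y s.2.2).1, (φ y s.2.2).2, s.1, s.2.1, s.2.2, y)) ≤
        ∑ ω, iid (Fin n) P ω * ind (Bad (letterBlockEquiv n _ _ _ _ _ _ ω)) +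
        (deviation P (infoDensity₁ P w₁) δ n + deviation P (infoDensity₂ P w₂) δ n +
          deviation P (infoDensity₁₂ P w₁ w₂) δ n) +
        2 * deviation P (fun ω => Real.log (L₁ (rvU₁ ω) (rvS₁ ω))) δ n +
        2 * deviation P (fun ω => Real.log (L₂ (rvU₂ ω) (rvS₂ ω))) δ n +
        8 * Real.exp (-(n * δ)) + 2 * Real.exp (-(n * (δ / 2))) := by
  have hP0 : ∀ ω, 0 ≤ P ω := hP ▸ h.law_nonneg
  have hi₁0 : 0 ≤ i₁ := by rw [hi₁, hP]; exact h.expect_log_nonneg₁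
  have hi₂0 : 0 ≤ i₂ := by rw [hi₂, hP]; exact h.expect_log_nonneg₂
  have hpos : ∀ {ω}, 0 < P ω → _ := fun {ω} hω => h.pos_of_law_pos (ω := ω) (hP ▸ hω)
  set J := blockDensityLaw n p w₁ L₁ w₂ L₂ V with hJ
  -- The rate is `2δ` above `i₁`: one `δ` lets the truncation level `exp(n(i₁ + δ))` exceed the
  -- typical density, the other gives the covering error `c = exp(-nδ/2)`, since `c²` costs a factor
  -- `exp(-nδ)`.
  set N₁ := ⌈Real.exp (n * (i₁ + 2 * δ))⌉₊ with hN₁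
  set N₂ := ⌈Real.exp (n * (i₂ + 2 * δ))⌉₊ with hN₂
  have : Nonempty (Fin N₁) := Fin.pos_iff_nonempty.1 (Nat.ceil_pos.2 (Real.exp_pos _))
  have : Nonempty (Fin N₂) := Fin.pos_iff_nonempty.1 (Nat.ceil_pos.2 (Real.exp_pos _))
  have hNle : ∀ i : ℝ, 0 ≤ i → (⌈Real.exp (n * (i + 2 * δ))⌉₊ : ℝ) ≤
      2 * Real.exp (n * (i + 2 * δ)) := fun i hi => by
    have h1 : (1 : ℝ) ≤ Real.exp (n * (i + 2 * δ)) := Real.one_le_exp (by positivity)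
    linarith [(Nat.ceil_lt_add_one (Real.exp_pos (n * (i + 2 * δ))).le).le]
  have hτ : ∀ i : ℝ, Real.exp (n * (i + δ)) ≤ Real.exp (-(n * (δ / 2))) ^ 2 *
      (⌈Real.exp (n * (i + 2 * δ))⌉₊ : ℝ) := fun i => by
    calc Real.exp (n * (i + δ)) = Real.exp (-(n * (δ / 2))) ^ 2 * Real.exp (n * (i + 2 * δ)) := by
          rw [sq, ← Real.exp_add, ← Real.exp_add]; congr 1; ring
      _ ≤ _ := by gcongr; exact Nat.le_ceil _
  -- The test asks each likelihood ratio to be at least `exp(n(k - δ))`. A competitor passes with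
  -- probability at most `exp(-n(k - δ))`; against codebooks of rate `i + 2δ` the slacks `4δ` and
  -- `6δ` leave `exp(-nδ)` in each of the three union bounds.
  set T : (Fin n → U₁) → (Fin n → U₂) → (Fin n → Y) → (Fin n → Z) → Prop := fun u₁ u₂ y z =>
    (iid (Fin n) w₁ u₁ * marginal J (fun ω => (rvU₂ ω, rvY ω, rvZ ω)) (u₂, y, z) ≤
      Real.exp (-(n * (k₁ - δ))) *
        marginal J (fun ω => (rvU₁ ω, rvU₂ ω, rvY ω, rvZ ω)) (u₁, u₂, y, z)) ∧
    (iid (Fin n) w₂ u₂ * marginal J (fun ω => (rvU₁ ω, rvY ω, rvZ ω)) (u₁, y, z) ≤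
      Real.exp (-(n * (k₂ - δ))) *
        marginal J (fun ω => (rvU₂ ω, rvU₁ ω, rvY ω, rvZ ω)) (u₂, u₁, y, z)) ∧
    (iid (Fin n) w₁ u₁ * iid (Fin n) w₂ u₂ * marginal J (fun ω => (rvY ω, rvZ ω)) (y, z) ≤
      Real.exp (-(n * (k₁₂ - δ))) *
        marginal J (fun ω => ((rvU₁ ω, rvU₂ ω), rvY ω, rvZ ω)) ((u₁, u₂), y, z)) with hT
  obtain ⟨e₁, e₂, φ, hφ⟩ := (h.block n).exists_code (ι₁ := Fin N₁) (ι₂ := Fin N₂)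
    (Real.exp_pos (-(n * (δ / 2)))) (Real.exp_pos (n * (i₁ + δ))).le
    (by rw [Fintype.card_fin]; exact hτ i₁)
    (Real.exp_pos (-(n * (δ / 2)))) (Real.exp_pos (n * (i₂ + δ))).le
    (by rw [Fintype.card_fin]; exact hτ i₂) T Bad (Real.exp_pos _).le (Real.exp_pos _).le
    (Real.exp_pos _).le (fun _ _ _ _ ht => ht.1) (fun _ _ _ _ ht => ht.2.1)
    (fun _ _ _ _ ht => ht.2.2)
  refine ⟨e₁, e₂, φ, hφ.trans ?_⟩
  rw [show densityLaw (blockSource n p) (iid (Fin n) w₁) (blockDensity n L₁) (iid (Fin n) w₂)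
    (blockDensity n L₂) (blockChannel n V) = J from rfl]
  simp only [Fintype.card_fin]
  -- the covering terms
  have b₁ : ∑ ω, J ω * ind (Real.exp (n * (i₁ + δ)) < blockDensity n L₁ (rvU₁ ω) (rvS₁ ω)) ≤
      deviation P (fun ω => Real.log (L₁ (rvU₁ ω) (rvS₁ ω))) δ n := by
    rw [hJ, sum_blockDensityLaw_mul, ← hP]
    refine sum_iid_ind_le_deviation hP0 _ δ n fun ω hω hE => ?_
    rw [← hi₁]
    exact le_abs_of_exp_lt_prod (fun i => (hpos (hω i)).2.1) hE
  have b₂ : ∑ ω, J ω * ind (Real.exp (n * (i₂ + δ)) < blockDensity n L₂ (rvU₂ ω) (rvS₂ ω)) ≤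
      deviation P (fun ω => Real.log (L₂ (rvU₂ ω) (rvS₂ ω))) δ n := by
    rw [hJ, sum_blockDensityLaw_mul, ← hP]
    refine sum_iid_ind_le_deviation hP0 _ δ n fun ω hω hE => ?_
    rw [← hi₂]
    exact le_abs_of_exp_lt_prod (fun i => (hpos (hω i)).2.2.2) hE
  -- the packing terms
  have m₁ : N₁ * Real.exp (-(n * (k₁ - δ))) ≤ 2 * Real.exp (-(n * δ)) := by
    calc (N₁ : ℝ) * Real.exp (-(n * (k₁ - δ)))
        ≤ 2 * Real.exp (n * (i₁ + 2 * δ)) * Real.exp (-(n * (k₁ - δ))) := by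
          gcongr; exact hNle i₁ hi₁0
      _ = 2 * Real.exp (n * (i₁ + 2 * δ) + -(n * (k₁ - δ))) := by rw [Real.exp_add]; ring
      _ ≤ _ := by
          gcongr
          have := mul_le_mul_of_nonneg_left h₁ (Nat.cast_nonneg (α := ℝ) n)
          linarith
  have m₂ : N₂ * Real.exp (-(n * (k₂ - δ))) ≤ 2 * Real.exp (-(n * δ)) := by
    calc (N₂ : ℝ) * Real.exp (-(n * (k₂ - δ)))
        ≤ 2 * Real.exp (n * (i₂ + 2 * δ)) * Real.exp (-(n * (k₂ - δ))) := by
          gcongr; exact hNle i₂ hi₂0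
      _ = 2 * Real.exp (n * (i₂ + 2 * δ) + -(n * (k₂ - δ))) := by rw [Real.exp_add]; ring
      _ ≤ _ := by
          gcongr
          have := mul_le_mul_of_nonneg_left h₂ (Nat.cast_nonneg (α := ℝ) n)
          linarith
  have m₁₂ : N₁ * N₂ * Real.exp (-(n * (k₁₂ - δ))) ≤ 4 * Real.exp (-(n * δ)) := by
    calc (N₁ : ℝ) * N₂ * Real.exp (-(n * (k₁₂ - δ)))
        ≤ (2 * Real.exp (n * (i₁ + 2 * δ))) * (2 * Real.exp (n * (i₂ + 2 * δ))) *
            Real.exp (-(n * (k₁₂ - δ))) := by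
          gcongr
          · exact hNle i₁ hi₁0
          · exact hNle i₂ hi₂0
      _ = 4 * Real.exp (n * (i₁ + 2 * δ) + n * (i₂ + 2 * δ) + -(n * (k₁₂ - δ))) := by
          rw [Real.exp_add, Real.exp_add]; ring
      _ ≤ _ := by
          gcongr
          have := mul_le_mul_of_nonneg_left h₁₂ (Nat.cast_nonneg (α := ℝ) n)
          linarith
  -- the test
  have hTfail : ∑ ω, J ω * ind (¬T (rvU₁ ω) (rvU₂ ω) (rvY ω) (rvZ ω)) ≤
      deviation P (infoDensity₁ P w₁) δ n + deviation P (infoDensity₂ P w₂) δ n +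
          deviation P (infoDensity₁₂ P w₁ w₂) δ n := by
    have hle : ∀ A B C : Prop, ind (¬(A ∧ B ∧ C)) ≤ ind (¬A) + ind (¬B) + ind (¬C) :=
      fun A B C => by
        by_cases hA : A <;> by_cases hB : B <;> by_cases hC : C <;> simp [ind, hA, hB, hC]
    have hJ0 : ∀ ω, 0 ≤ J ω := (h.block n).law_nonneg
    refine (Finset.sum_le_sum fun ω _ => mul_le_mul_of_nonneg_left (hle _ _ _) (hJ0 ω)).trans ?_
    simp only [mul_add, Finset.sum_add_distrib]
    refine add_le_add (add_le_add ?_ ?_) ?_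
    · rw [hJ, sum_blockDensityLaw_mul, ← hP]
      refine sum_iid_ind_le_deviation hP0 _ δ n fun ω hω hE => ?_
      rw [← hk₁]
      refine le_abs_of_likelihood_ratio_lt (fun i => (hω i).trans_le (le_marginal hP0 _ (ω i)))
        (fun i => (hpos (hω i)).1) (fun i => (hω i).trans_le (le_marginal hP0 _ (ω i))) ?_
      rw [not_le, marginal_blockDensityLaw (B := fun ω => (rvU₁ ω, rvU₂ ω, rvY ω, rvZ ω))
          (b := fun i => (rvU₁ (ω i), rvU₂ (ω i), rvY (ω i), rvZ (ω i))),
        marginal_blockDensityLaw (B := fun ω => (rvU₂ ω, rvY ω, rvZ ω))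
          (b := fun i => (rvU₂ (ω i), rvY (ω i), rvZ (ω i))), ← hP] at hE
      · exact hE
      · intro ω'; simp [funext_iff, letterBlockEquiv, rvU₁, rvU₂, rvY, rvZ, forall_and]
      · intro ω'; simp [funext_iff, letterBlockEquiv, rvU₁, rvU₂, rvY, rvZ, forall_and]
    · rw [hJ, sum_blockDensityLaw_mul, ← hP]
      refine sum_iid_ind_le_deviation hP0 _ δ n fun ω hω hE => ?_
      rw [← hk₂]
      refine le_abs_of_likelihood_ratio_lt (fun i => (hω i).trans_le (le_marginal hP0 _ (ω i)))
        (fun i => (hpos (hω i)).2.2.1) (fun i => (hω i).trans_le (le_marginal hP0 _ (ω i))) ?_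
      rw [not_le, marginal_blockDensityLaw (B := fun ω => (rvU₂ ω, rvU₁ ω, rvY ω, rvZ ω))
          (b := fun i => (rvU₂ (ω i), rvU₁ (ω i), rvY (ω i), rvZ (ω i))),
        marginal_blockDensityLaw (B := fun ω => (rvU₁ ω, rvY ω, rvZ ω))
          (b := fun i => (rvU₁ (ω i), rvY (ω i), rvZ (ω i))), ← hP] at hE
      · exact hE
      · intro ω'; simp [funext_iff, letterBlockEquiv, rvU₁, rvU₂, rvY, rvZ, forall_and]
      · intro ω'; simp [funext_iff, letterBlockEquiv, rvU₁, rvU₂, rvY, rvZ, forall_and]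
    · rw [hJ, sum_blockDensityLaw_mul, ← hP]
      refine sum_iid_ind_le_deviation hP0 _ δ n fun ω hω hE => ?_
      rw [← hk₁₂]
      refine le_abs_of_likelihood_ratio_lt (fun i => (hω i).trans_le (le_marginal hP0 _ (ω i)))
        (fun i => mul_pos (hpos (hω i)).1 (hpos (hω i)).2.2.1)
        (fun i => (hω i).trans_le (le_marginal hP0 _ (ω i))) ?_
      rw [not_le, marginal_blockDensityLaw (B := fun ω => ((rvU₁ ω, rvU₂ ω), rvY ω, rvZ ω))
          (b := fun i => ((rvU₁ (ω i), rvU₂ (ω i)), rvY (ω i), rvZ (ω i))),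
        marginal_blockDensityLaw (B := fun ω => (rvY ω, rvZ ω))
          (b := fun i => (rvY (ω i), rvZ (ω i))), ← hP] at hE
      · rw [Finset.prod_mul_distrib]; exact hE
      · intro ω'; simp [funext_iff, letterBlockEquiv, rvU₁, rvU₂, rvY, rvZ, forall_and]
      · intro ω'; simp [funext_iff, letterBlockEquiv, rvU₁, rvU₂, rvY, rvZ, forall_and]
  have hBad : ∑ ω, J ω * ind (Bad ω) =
      ∑ ω, iid (Fin n) P ω * ind (Bad (letterBlockEquiv n _ _ _ _ _ _ ω)) := by
    rw [hJ, sum_blockDensityLaw_mul, ← hP]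
  have hsplit : ∑ ω, J ω * (ind (Bad ω) + ind (¬T (rvU₁ ω) (rvU₂ ω) (rvY ω) (rvZ ω))) =
      ∑ ω, J ω * ind (Bad ω) + ∑ ω, J ω * ind (¬T (rvU₁ ω) (rvU₂ ω) (rvY ω) (rvZ ω)) := by
    simp only [mul_add, Finset.sum_add_distrib]
  linarith

end Asymptotics

/-! ### From expected information densities to conditional mutual informations -/

section Information

theorem marginal_eq_sum_ind {Ω α : Type*} [Fintype Ω] (P : Ω → ℝ) (A : Ω → α) (a : α) :
    marginal P A a = ∑ ω, P ω * ind (A ω = a) := by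
  classical
  refine Finset.sum_congr rfl fun ω _ => ?_
  by_cases h : A ω = a
  · simp [h, ind]
  · simp [h, ind]

theorem marginal_congr {Ω α β : Type*} [Fintype Ω] (P : Ω → ℝ) {A : Ω → α} {B : Ω → β} {a : α}
    {b : β} (h : ∀ ω, A ω = a ↔ B ω = b) : marginal P A a = marginal P B b := by
  simp only [marginal_eq_sum_ind, h]

theorem expect_congr_of_pos {Ω : Type*} [Fintype Ω] {P : Ω → ℝ} (hP : ∀ ω, 0 ≤ P ω)
    {f g : Ω → ℝ} (h : ∀ ω, 0 < P ω → f ω = g ω) : expect P f = expect P g :=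
  Finset.sum_congr rfl fun ω _ => by
    rcases (hP ω).eq_or_lt with h0 | h0
    · rw [← h0, zero_mul, zero_mul]
    · rw [h ω h0]

theorem expect_sub {Ω : Type*} [Fintype Ω] (P : Ω → ℝ) (f g : Ω → ℝ) :
    expect P (fun ω => f ω - g ω) = expect P f - expect P g := by
  simp [expect, mul_sub, Finset.sum_sub_distrib]

/-- If `A` has conditional law `l` given `(B, C)`, the difference `I(A;Y|C) - I(A;B|C)` is the
expectation of `log p(A|Y,C) - log l`. -/
theorem condMutualInfo_sub {Ω α β γ η : Type*} [Fintype Ω] {P : Ω → ℝ} (hP : ∀ ω, 0 ≤ P ω)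
    (A : Ω → α) (B : Ω → β) (Y : Ω → η) (C : Ω → γ) (l : Ω → ℝ)
    (hl : ∀ ω, 0 < P ω → marginal P (fun ω' => (A ω', B ω', C ω')) (A ω, B ω, C ω) =
      l ω * marginal P (fun ω' => (B ω', C ω')) (B ω, C ω)) :
    condMutualInfo P A Y C - condMutualInfo P A B C =
      expect P fun ω => Real.log (marginal P (fun ω' => (A ω', Y ω', C ω')) (A ω, Y ω, C ω) /
        marginal P (fun ω' => (Y ω', C ω')) (Y ω, C ω)) - Real.log (l ω) := by
  unfold condMutualInfo
  rw [← expect_sub]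
  refine expect_congr_of_pos hP fun ω hω => ?_
  have h1 := (hω.trans_le (le_marginal hP (fun ω' => (A ω', Y ω', C ω')) ω)).ne'
  have h2 := (hω.trans_le (le_marginal hP (fun ω' => (Y ω', C ω')) ω)).ne'
  have h3 := (hω.trans_le (le_marginal hP (fun ω' => (A ω', C ω')) ω)).ne'
  have h4 := (hω.trans_le (le_marginal hP C ω)).ne'
  have h5 := (hω.trans_le (le_marginal hP (fun ω' => (B ω', C ω')) ω)).ne'
  have h6 := (hω.trans_le (le_marginal hP (fun ω' => (A ω', B ω', C ω')) ω)).ne'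
  have hl0 : l ω ≠ 0 := fun h0 => h6 (by rw [hl ω hω, h0, zero_mul])
  rw [hl ω hω]
  rw [Real.log_div (mul_ne_zero h1 h4) (mul_ne_zero h3 h2), Real.log_mul h1 h4, Real.log_mul h3 h2,
    Real.log_div (mul_ne_zero (mul_ne_zero hl0 h5) h4) (mul_ne_zero h3 h5),
    Real.log_mul (mul_ne_zero hl0 h5) h4, Real.log_mul hl0 h5, Real.log_mul h3 h5,
    Real.log_div h1 h2]
  ring

variable {S₁ S₂ Z Y U₁ U₂ : Type*} [Fintype S₁] [Fintype S₂] [Fintype Z] [Fintype Y]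
  [Fintype U₁] [Fintype U₂]
  {p : S₁ × S₂ × Z → ℝ} {w₁ : U₁ → ℝ} {L₁ : U₁ → S₁ → ℝ} {w₂ : U₂ → ℝ}
  {L₂ : U₂ → S₂ → ℝ} {V : U₁ → S₁ → U₂ → S₂ → Y → ℝ}

theorem ind_and (A B : Prop) : ind (A ∧ B) = ind A * ind B := by
  by_cases hA : A <;> by_cases hB : B <;> simp [ind, hA, hB]

theorem sum_mul_ind_eq {U : Type*} [Fintype U] (f : U → ℝ) (a : U) :
    ∑ u, f u * ind (u = a) = f a := by
  rw [Finset.sum_eq_single a]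
  · simp [ind]
  · intro b _ hb; simp [ind, hb]
  · simp

namespace IsDensityData

/-- Given the sources, `U₁` is independent of `U₂` with law `w₁ u * L₁ u s₁`. As `K` vanishes off
`s₁ = b`, the conditional probability of `a` is the constant `w₁ a * L₁ a b` and leaves the sum. -/
theorem sum_law_mul_ind₁ (h : IsDensityData p w₁ L₁ w₂ L₂ V) (a : U₁) (b : S₁)
    (K : S₁ × S₂ × Z → U₂ → ℝ) (hK : ∀ s u, s.1 ≠ b → K s u = 0) :
    ∑ ω, densityLaw p w₁ L₁ w₂ L₂ V ω *
        (ind (rvU₁ ω = a) * K (rvS₁ ω, rvS₂ ω, rvZ ω) (rvU₂ ω)) =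
      w₁ a * L₁ a b *
        ∑ ω, densityLaw p w₁ L₁ w₂ L₂ V ω * K (rvS₁ ω, rvS₂ ω, rvZ ω) (rvU₂ ω) := by
  rw [sum_densityLaw_mul_source, sum_densityLaw_mul_source, Finset.mul_sum]
  refine Finset.sum_congr rfl fun s _ => ?_
  simp only [rvU₁, rvU₂, rvS₁, rvS₂, rvZ, Prod.mk.eta, ← Finset.sum_mul, h.V_sum, one_mul,
    h.L₁_sum]
  have e : ∀ u, w₁ u * L₁ u s.1 * ∑ v, w₂ v * L₂ v s.2.1 * (ind (u = a) * K s v) =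
      (w₁ u * L₁ u s.1 * ∑ v, w₂ v * L₂ v s.2.1 * K s v) * ind (u = a) := fun u => by
    rw [mul_assoc (_ * _), Finset.sum_mul]
    exact congrArg _ (Finset.sum_congr rfl fun v _ => by ring)
  simp only [e, sum_mul_ind_eq fun u => w₁ u * L₁ u s.1 * ∑ v, w₂ v * L₂ v s.2.1 * K s v]
  by_cases hs : s.1 = b
  · rw [hs]; ring
  · simp [hK s _ hs]

theorem sum_law_mul_ind₂ (h : IsDensityData p w₁ L₁ w₂ L₂ V) (a : U₂) (b : S₂)
    (K : S₁ × S₂ × Z → U₁ → ℝ) (hK : ∀ s u, s.2.1 ≠ b → K s u = 0) :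
    ∑ ω, densityLaw p w₁ L₁ w₂ L₂ V ω *
        (ind (rvU₂ ω = a) * K (rvS₁ ω, rvS₂ ω, rvZ ω) (rvU₁ ω)) =
      w₂ a * L₂ a b *
        ∑ ω, densityLaw p w₁ L₁ w₂ L₂ V ω * K (rvS₁ ω, rvS₂ ω, rvZ ω) (rvU₁ ω) := by
  rw [sum_densityLaw_mul_source, sum_densityLaw_mul_source, Finset.mul_sum]
  refine Finset.sum_congr rfl fun s _ => ?_
  simp only [rvU₁, rvU₂, rvS₁, rvS₂, rvZ, Prod.mk.eta, ← Finset.sum_mul, h.V_sum, one_mul,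
    h.L₂_sum]
  have e : ∀ u, ∑ v, w₂ v * L₂ v s.2.1 * (ind (v = a) * K s u) =
      w₂ a * L₂ a s.2.1 * K s u := fun u => by
    rw [← sum_mul_ind_eq (fun v => w₂ v * L₂ v s.2.1 * K s u)]
    exact Finset.sum_congr rfl fun v _ => by ring
  simp only [e]
  by_cases hs : s.2.1 = b
  · rw [hs]
    simp only [Finset.mul_sum]
    exact Finset.sum_congr rfl fun v _ => by ring
  · simp [hK s _ hs]

theorem marginal_factor₁ (h : IsDensityData p w₁ L₁ w₂ L₂ V) (u₁ : U₁) (s₁ : S₁) (u₂ : U₂) (z : Z) :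
    marginal (densityLaw p w₁ L₁ w₂ L₂ V) (fun ω => (rvU₁ ω, rvS₁ ω, rvU₂ ω, rvZ ω))
        (u₁, s₁, u₂, z) =
      w₁ u₁ * L₁ u₁ s₁ *
        marginal (densityLaw p w₁ L₁ w₂ L₂ V) (fun ω => (rvS₁ ω, rvU₂ ω, rvZ ω)) (s₁, u₂, z) := by
  have key := h.sum_law_mul_ind₁ u₁ s₁ (fun s u => ind ((s.1, u, s.2.2) = (s₁, u₂, z)))
    fun s u hs => ind_of_not fun hc => hs (Prod.mk.inj hc).1
  simp only [marginal_eq_sum_ind, Prod.mk.injEq, ind_and] at key ⊢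
  exact key

theorem marginal_factor₂ (h : IsDensityData p w₁ L₁ w₂ L₂ V) (u₂ : U₂) (s₂ : S₂) (u₁ : U₁) (z : Z) :
    marginal (densityLaw p w₁ L₁ w₂ L₂ V) (fun ω => (rvU₂ ω, rvS₂ ω, rvU₁ ω, rvZ ω))
        (u₂, s₂, u₁, z) =
      w₂ u₂ * L₂ u₂ s₂ *
        marginal (densityLaw p w₁ L₁ w₂ L₂ V) (fun ω => (rvS₂ ω, rvU₁ ω, rvZ ω)) (s₂, u₁, z) := by
  have key := h.sum_law_mul_ind₂ u₂ s₂ (fun s u => ind ((s.2.1, u, s.2.2) = (s₂, u₁, z)))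
    fun s u hs => ind_of_not fun hc => hs (Prod.mk.inj hc).1
  simp only [marginal_eq_sum_ind, Prod.mk.injEq, ind_and] at key ⊢
  exact key

/-- The two conditional laws are split off in turn; while `U₁` is removed, the constraint on `U₂` is
part of the kernel `K`. -/
theorem marginal_factor₁₂ (h : IsDensityData p w₁ L₁ w₂ L₂ V) (u₁ : U₁) (u₂ : U₂) (s₁ : S₁)
    (s₂ : S₂) (z : Z) :
    marginal (densityLaw p w₁ L₁ w₂ L₂ V) (fun ω => ((rvU₁ ω, rvU₂ ω), (rvS₁ ω, rvS₂ ω), rvZ ω))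
        ((u₁, u₂), (s₁, s₂), z) =
      w₁ u₁ * L₁ u₁ s₁ * (w₂ u₂ * L₂ u₂ s₂) *
        marginal (densityLaw p w₁ L₁ w₂ L₂ V) (fun ω => ((rvS₁ ω, rvS₂ ω), rvZ ω))
          ((s₁, s₂), z) := by
  have key₁ := h.sum_law_mul_ind₁ u₁ s₁
    (fun s u => ind (u = u₂) * ind (((s.1, s.2.1), s.2.2) = ((s₁, s₂), z)))
    fun s u hs => by rw [ind_of_not fun hc => hs (Prod.mk.inj (Prod.mk.inj hc).1).1, mul_zero]
  have key₂ := h.sum_law_mul_ind₂ u₂ s₂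
    (fun s u => ind (((s.1, s.2.1), s.2.2) = ((s₁, s₂), z)))
    fun s u hs => ind_of_not fun hc => hs (Prod.mk.inj (Prod.mk.inj hc).1).2
  rw [key₂] at key₁
  simp only [marginal_eq_sum_ind, Prod.mk.injEq, ind_and] at key₁ ⊢
  simp only [mul_assoc] at key₁ ⊢
  exact key₁

/-- The Markov property makes `w₁ * L₁` the conditional law of `U₁` given `(S₁, U₂, Z)`. The
reference law `w₁` enters both expectations on the right and cancels, so it need not be the law of
`U₁` here. -/
theorem condMutualInfo_sub₁ (h : IsDensityData p w₁ L₁ w₂ L₂ V)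
    {P : Letter U₁ U₂ S₁ S₂ Z Y → ℝ} (hP : P = densityLaw p w₁ L₁ w₂ L₂ V) :
    condMutualInfo P rvU₁ rvY (fun ω => (rvU₂ ω, rvZ ω)) -
        condMutualInfo P rvU₁ rvS₁ (fun ω => (rvU₂ ω, rvZ ω)) =
      expect P (infoDensity₁ P w₁) - expect P fun ω => Real.log (L₁ (rvU₁ ω) (rvS₁ ω)) := by
  have hP0 : ∀ ω, 0 ≤ P ω := hP ▸ h.law_nonneg
  rw [condMutualInfo_sub hP0 rvU₁ rvS₁ rvY (fun ω => (rvU₂ ω, rvZ ω))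
    (fun ω => w₁ (rvU₁ ω) * L₁ (rvU₁ ω) (rvS₁ ω))
    fun ω _ => hP ▸ h.marginal_factor₁ _ _ _ _, ← expect_sub]
  refine expect_congr_of_pos hP0 fun ω hω => ?_
  obtain ⟨hw, hL, -, -⟩ := h.pos_of_law_pos (hP ▸ hω)
  unfold infoDensity₁
  rw [marginal_congr P (A := fun ω' => (rvU₁ ω', rvY ω', rvU₂ ω', rvZ ω'))
      (B := fun ω => (rvU₁ ω, rvU₂ ω, rvY ω, rvZ ω)) (b := (rvU₁ ω, rvU₂ ω, rvY ω, rvZ ω))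
      (fun ω' => by simp only [Prod.mk.injEq]; tauto),
    marginal_congr P (A := fun ω' => (rvY ω', rvU₂ ω', rvZ ω'))
      (B := fun ω => (rvU₂ ω, rvY ω, rvZ ω)) (b := (rvU₂ ω, rvY ω, rvZ ω))
      (fun ω' => by simp only [Prod.mk.injEq]; tauto)]
  have h1 := (hω.trans_le (le_marginal hP0 (fun ω => (rvU₁ ω, rvU₂ ω, rvY ω, rvZ ω)) ω)).ne'
  have h2 := (hω.trans_le (le_marginal hP0 (fun ω => (rvU₂ ω, rvY ω, rvZ ω)) ω)).ne'
  rw [Real.log_div h1 h2, Real.log_div h1 (mul_ne_zero hw.ne' h2), Real.log_mul hw.ne' hL.ne',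
    Real.log_mul hw.ne' h2]
  ring

theorem condMutualInfo_sub₂ (h : IsDensityData p w₁ L₁ w₂ L₂ V)
    {P : Letter U₁ U₂ S₁ S₂ Z Y → ℝ} (hP : P = densityLaw p w₁ L₁ w₂ L₂ V) :
    condMutualInfo P rvU₂ rvY (fun ω => (rvU₁ ω, rvZ ω)) -
        condMutualInfo P rvU₂ rvS₂ (fun ω => (rvU₁ ω, rvZ ω)) =
      expect P (infoDensity₂ P w₂) - expect P fun ω => Real.log (L₂ (rvU₂ ω) (rvS₂ ω)) := by
  have hP0 : ∀ ω, 0 ≤ P ω := hP ▸ h.law_nonneg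
  rw [condMutualInfo_sub hP0 rvU₂ rvS₂ rvY (fun ω => (rvU₁ ω, rvZ ω))
    (fun ω => w₂ (rvU₂ ω) * L₂ (rvU₂ ω) (rvS₂ ω))
    fun ω _ => hP ▸ h.marginal_factor₂ _ _ _ _, ← expect_sub]
  refine expect_congr_of_pos hP0 fun ω hω => ?_
  obtain ⟨-, -, hw, hL⟩ := h.pos_of_law_pos (hP ▸ hω)
  unfold infoDensity₂
  rw [marginal_congr P (A := fun ω' => (rvU₂ ω', rvY ω', rvU₁ ω', rvZ ω'))
      (B := fun ω => (rvU₂ ω, rvU₁ ω, rvY ω, rvZ ω)) (b := (rvU₂ ω, rvU₁ ω, rvY ω, rvZ ω))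
      (fun ω' => by simp only [Prod.mk.injEq]; tauto),
    marginal_congr P (A := fun ω' => (rvY ω', rvU₁ ω', rvZ ω'))
      (B := fun ω => (rvU₁ ω, rvY ω, rvZ ω)) (b := (rvU₁ ω, rvY ω, rvZ ω))
      (fun ω' => by simp only [Prod.mk.injEq]; tauto)]
  have h1 := (hω.trans_le (le_marginal hP0 (fun ω => (rvU₂ ω, rvU₁ ω, rvY ω, rvZ ω)) ω)).ne'
  have h2 := (hω.trans_le (le_marginal hP0 (fun ω => (rvU₁ ω, rvY ω, rvZ ω)) ω)).ne'
  rw [Real.log_div h1 h2, Real.log_div h1 (mul_ne_zero hw.ne' h2), Real.log_mul hw.ne' hL.ne',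
    Real.log_mul hw.ne' h2]
  ring

theorem condMutualInfo_sub₁₂ (h : IsDensityData p w₁ L₁ w₂ L₂ V)
    {P : Letter U₁ U₂ S₁ S₂ Z Y → ℝ} (hP : P = densityLaw p w₁ L₁ w₂ L₂ V) :
    condMutualInfo P (fun ω => (rvU₁ ω, rvU₂ ω)) rvY rvZ -
        condMutualInfo P (fun ω => (rvU₁ ω, rvU₂ ω)) (fun ω => (rvS₁ ω, rvS₂ ω)) rvZ =
      expect P (infoDensity₁₂ P w₁ w₂) - (expect P fun ω => Real.log (L₁ (rvU₁ ω) (rvS₁ ω))) -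
        expect P fun ω => Real.log (L₂ (rvU₂ ω) (rvS₂ ω)) := by
  have hP0 : ∀ ω, 0 ≤ P ω := hP ▸ h.law_nonneg
  rw [condMutualInfo_sub hP0 (fun ω => (rvU₁ ω, rvU₂ ω)) (fun ω => (rvS₁ ω, rvS₂ ω)) rvY rvZ
    (fun ω => w₁ (rvU₁ ω) * L₁ (rvU₁ ω) (rvS₁ ω) * (w₂ (rvU₂ ω) * L₂ (rvU₂ ω) (rvS₂ ω)))
    fun ω _ => hP ▸ h.marginal_factor₁₂ _ _ _ _ _, ← expect_sub, ← expect_sub]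
  refine expect_congr_of_pos hP0 fun ω hω => ?_
  obtain ⟨hw₁, hL₁, hw₂, hL₂⟩ := h.pos_of_law_pos (hP ▸ hω)
  unfold infoDensity₁₂
  have h1 := (hω.trans_le (le_marginal hP0 (fun ω => ((rvU₁ ω, rvU₂ ω), rvY ω, rvZ ω)) ω)).ne'
  have h2 := (hω.trans_le (le_marginal hP0 (fun ω => (rvY ω, rvZ ω)) ω)).ne'
  rw [Real.log_div h1 h2, Real.log_div h1 (mul_ne_zero (mul_ne_zero hw₁.ne' hw₂.ne') h2),
    Real.log_mul (mul_ne_zero hw₁.ne' hL₁.ne') (mul_ne_zero hw₂.ne' hL₂.ne'),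
    Real.log_mul hw₁.ne' hL₁.ne', Real.log_mul hw₂.ne' hL₂.ne',
    Real.log_mul (mul_ne_zero hw₁.ne' hw₂.ne') h2, Real.log_mul hw₁.ne' hw₂.ne']
  ring

end IsDensityData

end Information

/-! ### Test channels as densities with respect to their output law -/

section TestChannel

theorem sum_toReal {α : Type*} [Fintype α] (p : PMF α) : ∑ a, (p a).toReal = 1 := by
  rw [← ENNReal.toReal_sum fun a _ => p.apply_ne_top a, ← tsum_fintype (L := .unconditional _),
    p.tsum_coe, ENNReal.toReal_one]

variable {S U : Type*} [Fintype S]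

/-- The output law of the channel `q` with input law `π`. -/
def outputLaw (π : S → ℝ) (q : S → U → ℝ) (u : U) : ℝ := ∑ s, π s * q s u

open Classical in
/-- The density of the channel `q` with respect to its output law, set to one at inputs of mass
zero. -/
def channelDensity (π : S → ℝ) (q : S → U → ℝ) (u : U) (s : S) : ℝ :=
  if π s = 0 then 1 else q s u / outputLaw π q u

variable {π : S → ℝ} {q : S → U → ℝ}

theorem outputLaw_nonneg (hπ : ∀ s, 0 ≤ π s) (hq : ∀ s u, 0 ≤ q s u) (u : U) :
    0 ≤ outputLaw π q u :=
  Finset.sum_nonneg fun s _ => mul_nonneg (hπ s) (hq s u)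

theorem sum_outputLaw [Fintype U] (hπ1 : ∑ s, π s = 1) (hq1 : ∀ s, ∑ u, q s u = 1) :
    ∑ u, outputLaw π q u = 1 := by
  simp only [outputLaw]
  rw [Finset.sum_comm]
  simp only [← Finset.mul_sum, hq1, mul_one, hπ1]

theorem channelDensity_nonneg (hπ : ∀ s, 0 ≤ π s) (hq : ∀ s u, 0 ≤ q s u) (u : U) (s : S) :
    0 ≤ channelDensity π q u s := by
  unfold channelDensity
  split_ifs
  · exact zero_le_one
  · exact div_nonneg (hq s u) (outputLaw_nonneg hπ hq u)

/-- Where the output law vanishes, so does `q s u` for every `s` of positive mass, and division by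
zero does no harm. -/
theorem outputLaw_mul_channelDensity (hπ : ∀ s, 0 ≤ π s) (hq : ∀ s u, 0 ≤ q s u) {s : S}
    (hs : π s ≠ 0) (u : U) : outputLaw π q u * channelDensity π q u s = q s u := by
  unfold channelDensity
  rw [if_neg hs]
  by_cases h0 : outputLaw π q u = 0
  · have h1 := (Finset.sum_eq_zero_iff_of_nonneg fun s _ => mul_nonneg (hπ s) (hq s u)).1 h0 s
      (Finset.mem_univ s)
    rw [(mul_eq_zero.1 h1).resolve_left hs]
    simp
  · field_simp

/-- At inputs of mass zero `q s` need not be absolutely continuous with respect to the output law;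
the default density one keeps the normalization valid for every `s`. -/
theorem sum_outputLaw_mul_channelDensity [Fintype U] (hπ : ∀ s, 0 ≤ π s) (hπ1 : ∑ s, π s = 1)
    (hq : ∀ s u, 0 ≤ q s u) (hq1 : ∀ s, ∑ u, q s u = 1) (s : S) :
    ∑ u, outputLaw π q u * channelDensity π q u s = 1 := by
  by_cases hs : π s = 0
  · simp [channelDensity, hs, sum_outputLaw hπ1 hq1]
  · simp only [outputLaw_mul_channelDensity hπ hq hs, hq1]

end TestChannel

/-! ### From the probability of the bad event to average distortion -/

section Distortion

/-- A block average is controlled by a good event and a bound on the rest. -/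
theorem average_expect_le {Ω : Type*} [Fintype Ω] {P : Ω → ℝ} (hP : ∀ ω, 0 ≤ P ω)
    (hP1 : ∑ ω, P ω = 1) {n : ℕ} (hn : 0 < n) {X : Fin n → Ω → ℝ} {Bad : Ω → Prop} {B D η r : ℝ}
    (hη : 0 ≤ η) (hX : ∀ i ω, X i ω ≤ B) (hgood : ∀ ω, ¬Bad ω → ∑ i, X i ω ≤ n * (D + η))
    (hB : 0 ≤ B) (hbad : ∑ ω, P ω * ind (Bad ω) ≤ r) :
    (1 / (n : ℝ)) * ∑ i, expect P (X i) ≤ D + η + (B + |D|) * r := by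
  have hn' : (0 : ℝ) < n := by exact_mod_cast hn
  -- The term `|D|` is there because `D` may be negative: `B ≤ D + (B + |D|)` in any case.
  have hpt : ∀ ω, ∑ i, X i ω ≤ n * (D + η) + n * (B + |D|) * ind (Bad ω) := fun ω => by
    by_cases h : Bad ω
    · rw [ind_of h]
      have h1 : ∑ i, X i ω ≤ n * B := by
        simpa using Finset.sum_le_sum (s := Finset.univ) fun i _ => hX i ω
      nlinarith [neg_abs_le D]
    · rw [ind_of_not h]; simpa using hgood ω h
  have h1 : ∑ i, expect P (X i) ≤ n * (D + η) + n * (B + |D|) * r := by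
    calc ∑ i, expect P (X i) = ∑ ω, P ω * ∑ i, X i ω := by
          simp only [expect, Finset.mul_sum]; rw [Finset.sum_comm]
      _ ≤ ∑ ω, P ω * (n * (D + η) + n * (B + |D|) * ind (Bad ω)) :=
          Finset.sum_le_sum fun ω _ => mul_le_mul_of_nonneg_left (hpt ω) (hP ω)
      _ = n * (D + η) * (∑ ω, P ω) + n * (B + |D|) * ∑ ω, P ω * ind (Bad ω) := by
          rw [Finset.mul_sum, Finset.mul_sum, ← Finset.sum_add_distrib]
          exact Finset.sum_congr rfl fun ω _ => by ring
      _ ≤ _ := by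
          rw [hP1, mul_one]; gcongr
  rw [one_div, inv_mul_le_iff₀ hn']
  linarith

end Distortion

/-! ### Assembling the code -/

section Achievability

variable {S₁ S₂ Z X₁ X₂ Y T₁ T₂ U₁ U₂ : Type*}
  [Fintype S₁] [Fintype S₂] [Fintype Z] [Fintype Y]

/-- The joint law does not see `q₁`, `q₂` at source letters of mass zero, so they can be replaced
there by the output laws of the test channels. -/
theorem isDensityData_of_pmf [Fintype U₁] [Fintype U₂] (p : PMF (S₁ × S₂ × Z)) (W : X₁ → X₂ → PMF Y)
    (q₁ : S₁ → PMF U₁) (q₂ : S₂ → PMF U₂) (x₁ : U₁ → S₁ → X₁) (x₂ : U₂ → S₂ → X₂) :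
    ∃ (w₁ : U₁ → ℝ) (L₁ : U₁ → S₁ → ℝ) (w₂ : U₂ → ℝ) (L₂ : U₂ → S₂ → ℝ),
      IsDensityData (fun s => (p s).toReal) w₁ L₁ w₂ L₂
        (fun u₁ s₁ u₂ s₂ y => (W (x₁ u₁ s₁) (x₂ u₂ s₂) y).toReal) ∧
      jointLaw p W q₁ q₂ x₁ x₂ = densityLaw (fun s => (p s).toReal) w₁ L₁ w₂ L₂
        (fun u₁ s₁ u₂ s₂ y => (W (x₁ u₁ s₁) (x₂ u₂ s₂) y).toReal) := by
  set pr : S₁ × S₂ × Z → ℝ := fun s => (p s).toReal with hpr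
  have hp0 : ∀ s, 0 ≤ pr s := fun s => ENNReal.toReal_nonneg
  have hp1 : ∑ s, pr s = 1 := sum_toReal p
  set π₁ := marginal pr fun s => s.1 with hπ₁
  set π₂ := marginal pr fun s => s.2.1 with hπ₂
  have h₁0 : ∀ s, 0 ≤ π₁ s := marginal_nonneg hp0 _
  have h₂0 : ∀ s, 0 ≤ π₂ s := marginal_nonneg hp0 _
  have h₁1 : ∑ s, π₁ s = 1 := (sum_marginal _ _).trans hp1
  have h₂1 : ∑ s, π₂ s = 1 := (sum_marginal _ _).trans hp1
  set r₁ : S₁ → U₁ → ℝ := fun s u => (q₁ s u).toReal with hr₁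
  set r₂ : S₂ → U₂ → ℝ := fun s u => (q₂ s u).toReal with hr₂
  have hr₁0 : ∀ s u, 0 ≤ r₁ s u := fun _ _ => ENNReal.toReal_nonneg
  have hr₂0 : ∀ s u, 0 ≤ r₂ s u := fun _ _ => ENNReal.toReal_nonneg
  have hr₁1 : ∀ s, ∑ u, r₁ s u = 1 := fun s => sum_toReal (q₁ s)
  have hr₂1 : ∀ s, ∑ u, r₂ s u = 1 := fun s => sum_toReal (q₂ s)
  refine ⟨outputLaw π₁ r₁, channelDensity π₁ r₁, outputLaw π₂ r₂, channelDensity π₂ r₂,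
    ⟨hp0, hp1, outputLaw_nonneg h₁0 hr₁0, sum_outputLaw h₁1 hr₁1, outputLaw_nonneg h₂0 hr₂0,
      sum_outputLaw h₂1 hr₂1, channelDensity_nonneg h₁0 hr₁0,
      sum_outputLaw_mul_channelDensity h₁0 h₁1 hr₁0 hr₁1, channelDensity_nonneg h₂0 hr₂0,
      sum_outputLaw_mul_channelDensity h₂0 h₂1 hr₂0 hr₂1,
      fun _ _ _ _ _ => ENNReal.toReal_nonneg, fun _ _ _ _ => sum_toReal _⟩, ?_⟩
  funext ⟨u₁, u₂, s₁, s₂, z, y⟩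
  simp only [jointLaw, densityLaw]
  rcases (hp0 (s₁, s₂, z)).eq_or_lt with h0 | h0
  · simp only [hpr] at h0
    simp [← h0, hpr]
  · have e₁ : π₁ s₁ ≠ 0 := (h0.trans_le (le_marginal hp0 (fun s => s.1) (s₁, s₂, z))).ne'
    have e₂ : π₂ s₂ ≠ 0 := (h0.trans_le (le_marginal hp0 (fun s => s.2.1) (s₁, s₂, z))).ne'
    rw [outputLaw_mul_channelDensity h₁0 hr₁0 e₁, outputLaw_mul_channelDensity h₂0 hr₂0 e₂]

theorem sum_blockLaw_mul (p : PMF (S₁ × S₂ × Z)) (W : X₁ → X₂ → PMF Y) {n : ℕ}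
    (x₁ : U₁ → S₁ → X₁) (x₂ : U₂ → S₂ → X₂)
    (e₁ : (Fin n → S₁) → (Fin n → U₁)) (e₂ : (Fin n → S₂) → (Fin n → U₂))
    (c : BlockCode S₁ S₂ Z X₁ X₂ Y T₁ T₂ n) (hc₁ : c.enc₁ = fun s i => x₁ (e₁ s i) (s i))
    (hc₂ : c.enc₂ = fun s i => x₂ (e₂ s i) (s i))
    (H : (Fin n → S₁) × (Fin n → S₂) × (Fin n → Z) → (Fin n → Y) → ℝ) :
    ∑ ω, blockLaw p W c ω * H (sourceBlockEquiv n S₁ S₂ Z ω.1) ω.2 =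
      ∑ s, ∑ y, blockSource n (fun s => (p s).toReal) s * blockChannel n
        (fun u₁ s₁ u₂ s₂ y => (W (x₁ u₁ s₁) (x₂ u₂ s₂) y).toReal)
        (e₁ s.1) s.1 (e₂ s.2.1) s.2.1 y * H s y := by
  rw [Fintype.sum_prod_type, ← (sourceBlockEquiv n S₁ S₂ Z).sum_comp]
  simp only [blockLaw, hc₁, hc₂]
  rfl

theorem achievable_of_densityData [Fintype T₁] [Fintype T₂] [Fintype U₁] [Fintype U₂]
    (p : PMF (S₁ × S₂ × Z)) (W : X₁ → X₂ → PMF Y)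
    (d₁ : S₁ → T₁ → ℝ) (d₂ : S₂ → T₂ → ℝ) (D₁ D₂ : ℝ)
    (x₁ : U₁ → S₁ → X₁) (x₂ : U₂ → S₂ → X₂)
    (g₁ : U₁ → U₂ → Y → Z → T₁) (g₂ : U₁ → U₂ → Y → Z → T₂)
    {w₁ : U₁ → ℝ} {L₁ : U₁ → S₁ → ℝ} {w₂ : U₂ → ℝ} {L₂ : U₂ → S₂ → ℝ}
    (h : IsDensityData (fun s => (p s).toReal) w₁ L₁ w₂ L₂
        (fun u₁ s₁ u₂ s₂ y => (W (x₁ u₁ s₁) (x₂ u₂ s₂) y).toReal))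
    {P : Letter U₁ U₂ S₁ S₂ Z Y → ℝ}
    (hP : P = densityLaw (fun s => (p s).toReal) w₁ L₁ w₂ L₂
        (fun u₁ s₁ u₂ s₂ y => (W (x₁ u₁ s₁) (x₂ u₂ s₂) y).toReal))
    (h₁ : (expect P fun ω => Real.log (L₁ (rvU₁ ω) (rvS₁ ω))) < expect P (infoDensity₁ P w₁))
    (h₂ : (expect P fun ω => Real.log (L₂ (rvU₂ ω) (rvS₂ ω))) < expect P (infoDensity₂ P w₂))
    (h₁₂ : (expect P fun ω => Real.log (L₁ (rvU₁ ω) (rvS₁ ω))) +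
        (expect P fun ω => Real.log (L₂ (rvU₂ ω) (rvS₂ ω))) <
      expect P (infoDensity₁₂ P w₁ w₂))
    (hD₁ : expect P (fun ω => d₁ (rvS₁ ω) (g₁ (rvU₁ ω) (rvU₂ ω) (rvY ω) (rvZ ω))) ≤ D₁)
    (hD₂ : expect P (fun ω => d₂ (rvS₂ ω) (g₂ (rvU₁ ω) (rvU₂ ω) (rvY ω) (rvZ ω))) ≤ D₂) :
    Achievable p W d₁ d₂ D₁ D₂ := by
  intro ε hε
  have hP0 : ∀ ω, 0 ≤ P ω := hP ▸ h.law_nonneg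
  have hP1 : ∑ ω, P ω = 1 := hP ▸ h.law_sum
  set i₁ := expect P fun ω => Real.log (L₁ (rvU₁ ω) (rvS₁ ω)) with hi₁
  set i₂ := expect P fun ω => Real.log (L₂ (rvU₂ ω) (rvS₂ ω)) with hi₂
  set k₁ := expect P (infoDensity₁ P w₁) with hk₁
  set k₂ := expect P (infoDensity₂ P w₂) with hk₂
  set k₁₂ := expect P (infoDensity₁₂ P w₁ w₂) with hk₁₂
  set f₁ : Letter U₁ U₂ S₁ S₂ Z Y → ℝ :=
    fun ω => d₁ (rvS₁ ω) (g₁ (rvU₁ ω) (rvU₂ ω) (rvY ω) (rvZ ω)) with hf₁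
  set f₂ : Letter U₁ U₂ S₁ S₂ Z Y → ℝ :=
    fun ω => d₂ (rvS₂ ω) (g₂ (rvU₁ ω) (rvU₂ ω) (rvY ω) (rvZ ω)) with hf₂
  -- The three strict inequalities leave room for the slacks required by the block code.
  obtain ⟨δ, hδ, hδ₁, hδ₂, hδ₁₂⟩ : ∃ δ : ℝ, 0 < δ ∧ i₁ + 4 * δ ≤ k₁ ∧ i₂ + 4 * δ ≤ k₂ ∧
      i₁ + i₂ + 6 * δ ≤ k₁₂ := by
    refine ⟨min (min ((k₁ - i₁) / 4) ((k₂ - i₂) / 4)) ((k₁₂ - i₁ - i₂) / 6), ?_, ?_, ?_, ?_⟩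
    · refine lt_min (lt_min ?_ ?_) ?_ <;> linarith
    · linarith [min_le_left (min ((k₁ - i₁) / 4) ((k₂ - i₂) / 4)) ((k₁₂ - i₁ - i₂) / 6),
        min_le_left ((k₁ - i₁) / 4) ((k₂ - i₂) / 4)]
    · linarith [min_le_left (min ((k₁ - i₁) / 4) ((k₂ - i₂) / 4)) ((k₁₂ - i₁ - i₂) / 6),
        min_le_right ((k₁ - i₁) / 4) ((k₂ - i₂) / 4)]
    · linarith [min_le_right (min ((k₁ - i₁) / 4) ((k₂ - i₂) / 4)) ((k₁₂ - i₁ - i₂) / 6)]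
  set B₁ := ∑ s, ∑ t, |d₁ s t| with hB₁
  set B₂ := ∑ s, ∑ t, |d₂ s t| with hB₂
  have hB₁0 : 0 ≤ B₁ := Finset.sum_nonneg fun _ _ => Finset.sum_nonneg fun _ _ => abs_nonneg _
  have hB₂0 : 0 ≤ B₂ := Finset.sum_nonneg fun _ _ => Finset.sum_nonneg fun _ _ => abs_nonneg _
  have hdB₁ : ∀ s t, d₁ s t ≤ B₁ := fun s t => (le_abs_self _).trans
    ((Finset.single_le_sum (f := fun t => |d₁ s t|) (fun _ _ => abs_nonneg _)
      (Finset.mem_univ t)).trans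
      (Finset.single_le_sum (f := fun s => ∑ t, |d₁ s t|)
        (fun _ _ => Finset.sum_nonneg fun _ _ => abs_nonneg _) (Finset.mem_univ s)))
  have hdB₂ : ∀ s t, d₂ s t ≤ B₂ := fun s t => (le_abs_self _).trans
    ((Finset.single_le_sum (f := fun t => |d₂ s t|) (fun _ _ => abs_nonneg _)
      (Finset.mem_univ t)).trans
      (Finset.single_le_sum (f := fun s => ∑ t, |d₂ s t|)
        (fun _ _ => Finset.sum_nonneg fun _ _ => abs_nonneg _) (Finset.mem_univ s)))
  -- The total error bound. Every term tends to zero, by the law of large numbers or as an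
  -- exponential.
  set r : ℕ → ℝ := fun n => (deviation P f₁ (ε / 2) n + deviation P f₂ (ε / 2) n) +
        (deviation P (infoDensity₁ P w₁) δ n + deviation P (infoDensity₂ P w₂) δ n +
          deviation P (infoDensity₁₂ P w₁ w₂) δ n) +
        2 * deviation P (fun ω => Real.log (L₁ (rvU₁ ω) (rvS₁ ω))) δ n +
        2 * deviation P (fun ω => Real.log (L₂ (rvU₂ ω) (rvS₂ ω))) δ n +
        8 * Real.exp (-(n * δ)) + 2 * Real.exp (-(n * (δ / 2))) with hr
  have hexp : ∀ a : ℝ, 0 < a →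
      Filter.Tendsto (fun n : ℕ => Real.exp (-(n * a))) Filter.atTop (nhds 0) := fun a ha =>
    Real.tendsto_exp_neg_atTop_nhds_zero.comp (tendsto_natCast_atTop_atTop.atTop_mul_const ha)
  have hr0 : Filter.Tendsto r Filter.atTop (nhds 0) := by
    have hd : ∀ f, Filter.Tendsto (deviation P f δ) Filter.atTop (nhds 0) :=
      fun f => tendsto_deviation hP0 hP1 f hδ
    have hε2 : ∀ f, Filter.Tendsto (deviation P f (ε / 2)) Filter.atTop (nhds 0) :=
      fun f => tendsto_deviation hP0 hP1 f (by positivity)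
    simpa using ((((((hε2 f₁).add (hε2 f₂)).add (((hd (infoDensity₁ P w₁)).add
      (hd (infoDensity₂ P w₂))).add (hd (infoDensity₁₂ P w₁ w₂)))).add
      ((hd fun ω => Real.log (L₁ (rvU₁ ω) (rvS₁ ω))).const_mul 2)).add
      ((hd fun ω => Real.log (L₂ (rvU₂ ω) (rvS₂ ω))).const_mul 2)).add
      ((hexp δ hδ).const_mul 8)).add ((hexp (δ / 2) (by positivity)).const_mul 2)
  have hsmall : ∀ B : ℝ, ∀ᶠ n in Filter.atTop, B * r n < ε / 2 := fun B => by
    have := hr0.const_mul B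
    rw [mul_zero] at this
    exact this.eventually (gt_mem_nhds (by positivity))
  obtain ⟨N, hN⟩ := Filter.eventually_atTop.1
    (((hsmall (B₁ + |D₁|)).and (hsmall (B₂ + |D₂|))).and (Filter.eventually_gt_atTop 0))
  refine ⟨N, fun n hn => ?_⟩
  obtain ⟨⟨hs₁, hs₂⟩, hn0⟩ := hN n hn
  set Bad₁ : Letter (Fin n → U₁) (Fin n → U₂) (Fin n → S₁) (Fin n → S₂) (Fin n → Z)
      (Fin n → Y) → Prop := fun t => n * (D₁ + ε / 2) <
    ∑ i, d₁ (rvS₁ t i) (g₁ (rvU₁ t i) (rvU₂ t i) (rvY t i) (rvZ t i)) with hBad₁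
  set Bad₂ : Letter (Fin n → U₁) (Fin n → U₂) (Fin n → S₁) (Fin n → S₂) (Fin n → Z)
      (Fin n → Y) → Prop := fun t => n * (D₂ + ε / 2) <
    ∑ i, d₂ (rvS₂ t i) (g₂ (rvU₁ t i) (rvU₂ t i) (rvY t i) (rvZ t i)) with hBad₂
  -- Both distortion failures are put into a single bad event, so that one code serves both sources.
  obtain ⟨e₁, e₂, φ, hφ⟩ := h.exists_block_code (n := n) hδ hP hi₁ hi₂ hk₁ hk₂ hk₁₂ hδ₁ hδ₂ hδ₁₂
    fun t => Bad₁ t ∨ Bad₂ t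
  have hdev : ∀ (f : Letter U₁ U₂ S₁ S₂ Z Y → ℝ) (D : ℝ), expect P f ≤ D →
      ∑ ω : Fin n → Letter U₁ U₂ S₁ S₂ Z Y,
        iid (Fin n) P ω * ind (n * (D + ε / 2) < ∑ i, f (ω i)) ≤ deviation P f (ε / 2) n :=
    fun f D hfD => sum_iid_ind_le_deviation hP0 f (ε / 2) n fun ω _ hE => by
      have := mul_le_mul_of_nonneg_left hfD (Nat.cast_nonneg (α := ℝ) n)
      -- As `expect P f ≤ D`, exceeding `n * (D + ε / 2)` means exceeding the expectation by at
      -- least `n * (ε / 2)`.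
      exact le_trans (by linarith) (le_abs_self _)
  have hbad : ∑ ω, iid (Fin n) P ω * ind (Bad₁ (letterBlockEquiv n _ _ _ _ _ _ ω) ∨
      Bad₂ (letterBlockEquiv n _ _ _ _ _ _ ω)) ≤
      deviation P f₁ (ε / 2) n + deviation P f₂ (ε / 2) n := by
    refine le_trans ?_ (add_le_add (hdev f₁ D₁ hD₁) (hdev f₂ D₂ hD₂))
    rw [← Finset.sum_add_distrib]
    refine Finset.sum_le_sum fun ω _ => ?_
    rw [← mul_add]
    refine mul_le_mul_of_nonneg_left ?_ (iid_nonneg hP0 ω)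
    have hor : ∀ A B : Prop, ind (A ∨ B) ≤ ind A + ind B := fun A B => by
      by_cases hA : A <;> by_cases hB : B <;> simp [ind, hA, hB]
    exact hor _ _
  have herr := hφ.trans (show _ ≤ r n by simp only [hr]; linarith)
  set c : BlockCode S₁ S₂ Z X₁ X₂ Y T₁ T₂ n :=
    { enc₁ := fun s i => x₁ (e₁ s i) (s i)
      enc₂ := fun s i => x₂ (e₂ s i) (s i)
      dec₁ := fun y z i => g₁ ((φ y z).1 i) ((φ y z).2 i) (y i) (z i)
      dec₂ := fun y z i => g₂ ((φ y z).1 i) ((φ y z).2 i) (y i) (z i) } with hc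
  have hlaw0 : ∀ ω, 0 ≤ blockLaw p W c ω := fun ω => mul_nonneg
    (Finset.prod_nonneg fun _ _ => ENNReal.toReal_nonneg)
    (Finset.prod_nonneg fun _ _ => ENNReal.toReal_nonneg)
  have hlaw := sum_blockLaw_mul p W x₁ x₂ e₁ e₂ c rfl rfl
  have hlaw1 : ∑ ω, blockLaw p W c ω = 1 := by
    have := hlaw fun _ _ => 1
    simp only [mul_one, ← Finset.mul_sum, (h.block n).V_sum, (h.block n).p_sum] at this
    exact this
  set Err : (Fin n → S₁ × S₂ × Z) × (Fin n → Y) → Prop := fun ω =>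
    Bad₁ ((φ ω.2 fun k => (ω.1 k).2.2).1, (φ ω.2 fun k => (ω.1 k).2.2).2, fun k => (ω.1 k).1,
      fun k => (ω.1 k).2.1, fun k => (ω.1 k).2.2, ω.2) ∨
    Bad₂ ((φ ω.2 fun k => (ω.1 k).2.2).1, (φ ω.2 fun k => (ω.1 k).2.2).2, fun k => (ω.1 k).1,
      fun k => (ω.1 k).2.1, fun k => (ω.1 k).2.2, ω.2) with hErr
  have hErr_le : ∑ ω, blockLaw p W c ω * ind (Err ω) ≤ r n := by
    refine le_trans (le_of_eq ?_) herr
    exact hlaw fun s y => ind (Bad₁ ((φ y s.2.2).1, (φ y s.2.2).2, s.1, s.2.1, s.2.2, y) ∨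
      Bad₂ ((φ y s.2.2).1, (φ y s.2.2).2, s.1, s.2.1, s.2.2, y))
  -- Half of `ε` is spent on the distortion allowed off the bad event, the other half on the bad
  -- event itself.
  have hfin₁ : D₁ + ε / 2 + (B₁ + |D₁|) * r n ≤ D₁ + ε := by linarith only [hs₁]
  have hfin₂ : D₂ + ε / 2 + (B₂ + |D₂|) * r n ≤ D₂ + ε := by linarith only [hs₂]
  refine ⟨c, ?_, ?_⟩
  · refine le_trans (le_of_eq ?_) ((average_expect_le hlaw0 hlaw1 hn0
      (X := fun i ω => d₁ (ω.1 i).1 (c.dec₁ ω.2 (fun k => (ω.1 k).2.2) i))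
      (Bad := Err) (B := B₁) (D := D₁) (η := ε / 2)
      (by positivity) (fun i ω => hdB₁ _ _) (fun ω hω => ?_) hB₁0 hErr_le).trans hfin₁)
    · simp only [avgDistortion₁, expect, Nat.cast_one]
    · exact not_lt.1 fun hlt => hω (Or.inl hlt)
  · refine le_trans (le_of_eq ?_) ((average_expect_le hlaw0 hlaw1 hn0
      (X := fun i ω => d₂ (ω.1 i).2.1 (c.dec₂ ω.2 (fun k => (ω.1 k).2.2) i))
      (Bad := Err) (B := B₂) (D := D₂) (η := ε / 2)
      (by positivity) (fun i ω => hdB₂ _ _) (fun ω hω => ?_) hB₂0 hErr_le).trans hfin₂)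
    · simp only [avgDistortion₂, expect, Nat.cast_one]
    · exact not_lt.1 fun hlt => hω (Or.inr hlt)

end Achievability

end

end HybridMAC

open HybridMAC in
theorem mainTheorem2
    {S₁ S₂ Z X₁ X₂ Y T₁ T₂ U₁ U₂ : Type*}
    [Fintype S₁] [Fintype S₂] [Fintype Z] [Fintype X₁] [Fintype X₂] [Fintype Y]
    [Fintype T₁] [Fintype T₂] [Fintype U₁] [Fintype U₂]
    (p : PMF (S₁ × S₂ × Z)) (W : X₁ → X₂ → PMF Y)
    (d₁ : S₁ → T₁ → ℝ) (d₂ : S₂ → T₂ → ℝ) (D₁ D₂ : ℝ)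
    (q₁ : S₁ → PMF U₁) (q₂ : S₂ → PMF U₂)
    (x₁ : U₁ → S₁ → X₁) (x₂ : U₂ → S₂ → X₂)
    (g₁ : U₁ → U₂ → Y → Z → T₁) (g₂ : U₁ → U₂ → Y → Z → T₂)
    (P : Letter U₁ U₂ S₁ S₂ Z Y → ℝ) (hP : P = jointLaw p W q₁ q₂ x₁ x₂)
    (h₁ : condMutualInfo P rvU₁ rvS₁ (fun ω => (rvU₂ ω, rvZ ω)) <
      condMutualInfo P rvU₁ rvY (fun ω => (rvU₂ ω, rvZ ω)))
    (h₂ : condMutualInfo P rvU₂ rvS₂ (fun ω => (rvU₁ ω, rvZ ω)) <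
      condMutualInfo P rvU₂ rvY (fun ω => (rvU₁ ω, rvZ ω)))
    (h₁₂ : condMutualInfo P (fun ω => (rvU₁ ω, rvU₂ ω)) (fun ω => (rvS₁ ω, rvS₂ ω)) rvZ <
      condMutualInfo P (fun ω => (rvU₁ ω, rvU₂ ω)) rvY rvZ)
    (hD₁ : expect P (fun ω => d₁ (rvS₁ ω) (g₁ (rvU₁ ω) (rvU₂ ω) (rvY ω) (rvZ ω))) ≤ D₁)
    (hD₂ : expect P (fun ω => d₂ (rvS₂ ω) (g₂ (rvU₁ ω) (rvU₂ ω) (rvY ω) (rvZ ω))) ≤ D₂) :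
    Achievable p W d₁ d₂ D₁ D₂ := by
  obtain ⟨w₁, L₁, w₂, L₂, h, hJ⟩ := isDensityData_of_pmf p W q₁ q₂ x₁ x₂
  have hP' := hP.trans hJ
  have e₁ := h.condMutualInfo_sub₁ hP'
  have e₂ := h.condMutualInfo_sub₂ hP'
  have e₁₂ := h.condMutualInfo_sub₁₂ hP'
  exact achievable_of_densityData p W d₁ d₂ D₁ D₂ x₁ x₂ g₁ g₂ h hP' (by linarith) (by linarith)
    (by linarith) hD₁ hD₂
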